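/- Let $N \ge 2$ and $L > \ell > 0$, and set $$\Omega = \{ z \in \mathbb R^N : z_N > 0 \},\quad E = \{ z \in \mathbb R^N : z_N > \ell \},\quad F = \{ z \in \mathbb R^N : z_N > L \}.$$ Let $D \subset \mathbb R^N$ be a domain (a nonempty connected open set) with $C^2$ boundary such that $F \subset D \subset E$. Let $\sigma_c \neq \sigma_s$ be positive constants, and put $$\sigma_1 = \begin{cases} \sigma_c & \text{in } D,\\ \sigma_s & \text{in } \Omega \setminus D,\end{cases} \qquad \sigma_2(t) = \begin{cases} \sigma_c & \text{if } t > \ell,\\ \sigma_s & \text{if } 0 < t \le \ell. \end{cases}$$ Let $w_1 \in H^1_{loc}(\Omega) \cap L^\infty(\Omega)$ and $w_2 \in H^1_{loc}((0,\infty)) \cap L^\infty((0,\infty))$ satisfy, in the weak sense (tested against smooth compactly supported functions, nonnegative ones for the inequality), $$-\mathrm{div}(\sigma_1 \nabla w_1) + w_1 = 0 \ \text{ in } \Omega, \qquad -(\sigma_2 w_2')' + w_2 \ge 0 \ \text{ in } (0,\infty),$$ and $w_1(z) = w_2(z_N)$ for almost every $z \in \Omega \setminus E$. Suppose that $$\left(\sigma_c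 w_2'(z_N) - \sigma_s \frac{\partial w_1}{\partial z_N}(z)\right)\left(w_2'(z_N) - \frac{\partial w_1}{\partial z_N}(z)\right) \ge 0 \quad \text{for almost every } z \in E \setminus \overline{D},$$ where the derivatives are weak derivatives. Then $w_1(z) \le w_2(z_N)$ for almost every $z \in \Omega$; if moreover $w_1$ and $w_2$ denote continuous representatives, then the inequality holds for every $z \in \Omega$. -/

import Mathlib

open MeasureTheory Set
open scoped ContDiff

noncomputable section

/-! ### Weak derivatives, local Sobolev functions and weak solutions

Everything in this section is used with `V = ℝ` and `V = EuclideanSpace ℝ (Fin (n + 1))`, equipped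
with Lebesgue measure. -/

section Sobolev

variable {V : Type*} [NormedAddCommGroup V] [InnerProductSpace ℝ V] [MeasureSpace V]

/-- `φ ∈ C_c^∞(U)`. -/
structure IsTestFunction (U : Set V) (φ : V → ℝ) : Prop where
  smooth : ContDiff ℝ ∞ φ
  compactSupport : HasCompactSupport φ
  support_subset : tsupport φ ⊆ U

/-- `w ∈ H^1_loc(U)` with weak gradient `G`: both `w` and `G` are square integrable on every
compact subset of `U`, and `∫_U w ∂_e φ = - ∫_U φ ⟨G, e⟩` for all test functions `φ` on `U` and all
directions `e`. For `V = ℝ`, `G` is the weak derivative of `w`. -/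
structure HasH1LocGradient (U : Set V) (w : V → ℝ) (G : V → V) : Prop where
  memLp_function : ∀ K : Set V, K ⊆ U → IsCompact K → MemLp w 2 (volume.restrict K)
  memLp_gradient : ∀ K : Set V, K ⊆ U → IsCompact K → MemLp G 2 (volume.restrict K)
  integral_eq : ∀ φ : V → ℝ, IsTestFunction U φ → ∀ e : V,
    ∫ z in U, w z * fderiv ℝ φ z e = - ∫ z in U, φ z * inner ℝ (G z) e

/-- `∫_U (σ ∇w · ∇φ + w φ)`, where `G` stands for `∇w`, so that `fderiv ℝ φ z (G z) = ∇w · ∇φ`. -/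
def weakForm (U : Set V) (σ w : V → ℝ) (G : V → V) (φ : V → ℝ) : ℝ :=
  ∫ z in U, (σ z * fderiv ℝ φ z (G z) + w z * φ z)

/-- `- div (σ ∇w) + w = 0` in `U` in the weak sense, `G` being the weak gradient of `w`. -/
def IsWeakSolution (U : Set V) (σ w : V → ℝ) (G : V → V) : Prop :=
  ∀ φ : V → ℝ, IsTestFunction U φ → weakForm U σ w G φ = 0

/-- `- div (σ ∇w) + w ≥ 0` in `U` in the weak sense, `G` being the weak gradient of `w`. -/
def IsWeakSupersolution (U : Set V) (σ w : V → ℝ) (G : V → V) : Prop :=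
  ∀ φ : V → ℝ, IsTestFunction U φ → (∀ z, 0 ≤ φ z) → 0 ≤ weakForm U σ w G φ

/-- `w ∈ L^∞(U)`. -/
def MemLInfty (U : Set V) (w : V → ℝ) : Prop :=
  MemLp w ⊤ (volume.restrict U)

end Sobolev

/-- `D` has `C^2` boundary: near each of its boundary points, `D` is the set where a `C^2` function
with nonvanishing differential is negative. -/
def HasC2Boundary {V : Type*} [NormedAddCommGroup V] [NormedSpace ℝ V] (D : Set V) : Prop :=
  ∀ p ∈ frontier D, ∃ (U : Set V) (ρ : V → ℝ), IsOpen U ∧ p ∈ U ∧ ContDiffOn ℝ 2 ρ U ∧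
    (∀ z ∈ U, fderiv ℝ ρ z ≠ 0) ∧ D ∩ U = {z ∈ U | ρ z < 0}

open Classical in
/-- The two-phase conductivity equal to `σc` in `A` and to `σs` outside `A`. -/
def conductivity {V : Type*} (A : Set V) (σc σs : ℝ) (z : V) : ℝ :=
  if z ∈ A then σc else σs

/-- The open half-space `{z ∈ ℝ^N : z_N > a}`, where `N = n + 1`. -/
def halfSpace (n : ℕ) (a : ℝ) : Set (EuclideanSpace ℝ (Fin (n + 1))) :=
  {z | a < z (Fin.last n)}

end

/-! Put v(z) = w₁(z) - w₂(z_N), let σ₂ be evaluated at z_N, and put A = σ₁∇w₁ - σ₂∇w₂. Lifted from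
the half-line to Ω by Fubini, `w₂` is still a supersolution (`IsWeakSupersolution.comp_last`), so
-div A + v ≤ 0 weakly. This is tested with Φ(v)η², where Φ(t) = exp(-1/t) for t > 0 and Φ = 0
otherwise, and η is a cutoff at scale R (`HasH1LocGradient.integral_le_zero_of_weak_le`). Only
points with v > 0 contribute, and these lie in E because v = 0 on Ω \ E.

The flux A is not a multiple of ∇v between E and D, which is where the sign hypothesis enters. Let P
be the horizontal part of ∇w₁. On E \ D̄, A·∇v is σs|P|² plus the product assumed nonnegative. No
vertical part of A is controlled there, so η is chosen with ∂η/∂z_N = 0 wherever ℓ < z_N ≤ L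
(`exists_cutoff`). Since E \ D lies in that slab, ∇η·A = σs ∇η·P, and |P| plays the role that |∇v|
plays inside D, where A = σc∇v (`exists_flux_bound`).

As Φ' = t⁻²Φ, Young's inequality absorbs the cross term at the cost of a multiple of v²Φ(v)|∇η|²,
and boundedness of v turns this into a multiple of vΦ(v)/R² (`young_absorb`). So f(R), the integral
of vΦ(v) over Ω ∩ B_R, satisfies f(R) ≤ C R⁻² f(2R). It grows at most like R^N, so iterating over
doublings forces f = 0 for large R, that is v ≤ 0 (`ae_nonpos_of_caccioppoli`). -/

/-! ### Mollification in L². -/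

section Mollification

open Filter Topology ContinuousLinearMap
open scoped Convolution ENNReal

variable {V : Type*} [NormedAddCommGroup V] [InnerProductSpace ℝ V] [FiniteDimensional ℝ V]
  [MeasurableSpace V] [BorelSpace V] {μ : Measure V} [μ.IsAddHaarMeasure]
  {E : Type*} [NormedAddCommGroup E] [NormedSpace ℝ E]

/-- Translations act continuously on `L²`. -/
theorem tendsto_eLpNorm_comp_sub_sub_self {F : Type*} [NormedAddCommGroup F]
    {f : V → F} (hf : MemLp f 2 μ) :
    Tendsto (fun y ↦ eLpNorm (fun x ↦ f (x - y) - f x) 2 μ) (𝓝 0) (𝓝 0) := by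
  have : Fact ((2 : ℝ≥0∞) ≠ ⊤) := ⟨by simp⟩
  -- The action of c is f ↦ f(c + ·), hence the sign.
  let T : V → Lp F 2 μ := fun y ↦ DomAddAct.mk (-y) +ᵥ hf.toLp f
  have hT : Continuous T :=
    (DomAddAct.continuous_mk.comp continuous_neg).vadd continuous_const
  have h0 : T 0 = hf.toLp f := by simp [T]
  have h1 : Tendsto (fun y ↦ edist (T y) (hf.toLp f)) (𝓝 0) (𝓝 0) := by
    have h := (hT.edist (continuous_const (y := hf.toLp f))).tendsto 0
    rwa [h0, edist_self] at h
  refine h1.congr fun y ↦ ?_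
  simp only [T]
  rw [DomAddAct.mk_vadd_toLp, Lp.edist_toLp_toLp]
  refine congrArg (fun g ↦ eLpNorm g 2 μ) (funext fun x ↦ ?_)
  simp [vadd_eq_add, sub_eq_neg_add]

/-- Convolution with a normalized bump moves a function in `L²` at most as much as the
translations by vectors in the support of the bump do. -/
theorem eLpNorm_normed_convolution_sub_le [CompleteSpace E] (ρ : ContDiffBump (0 : V)) {f : V → E}
    (hf : MemLp f 2 μ) {ε : ℝ≥0∞}
    (hε : ∀ y, ‖y‖ < ρ.rOut → eLpNorm (fun x ↦ f (x - y) - f x) 2 μ ≤ ε) :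
    eLpNorm ((ρ.normed μ ⋆[lsmul ℝ ℝ, μ] f) - f) 2 μ ≤ ε := by
  set r : V → ℝ≥0∞ := fun y ↦ ENNReal.ofReal (ρ.normed μ y) with hr
  have hρc : Continuous (ρ.normed μ) := ρ.continuous_normed
  have hrm : Measurable r := hρc.measurable.ennreal_ofReal
  have hr1 : ∫⁻ y, r y ∂μ = 1 := by
    rw [hr, ← ofReal_integral_eq_lintegral_ofReal ρ.integrable_normed
      (ae_of_all _ fun x ↦ ρ.nonneg_normed x), ρ.integral_normed, ENNReal.ofReal_one]
  -- The bump is read as a probability density: Jensen's inequality under `P` (L¹ norm at most L²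
  -- norm) gives the squared pointwise bound, and Tonelli then integrates it in x.
  set P := μ.withDensity r with hP
  have : IsProbabilityMeasure P := ⟨by rw [hP, withDensity_apply _ MeasurableSet.univ]; simpa⟩
  have hmeas : AEStronglyMeasurable (fun p : V × V ↦ f (p.1 - p.2) - f p.1) (μ.prod μ) :=
    (hf.1.comp_quasiMeasurePreserving (quasiMeasurePreserving_sub_of_right_invariant μ μ)).sub
      hf.1.comp_fst
  have hpt : ∀ x, ‖((ρ.normed μ ⋆[lsmul ℝ ℝ, μ] f) - f) x‖ₑ ^ (2 : ℝ) ≤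
      ∫⁻ y, r y * ‖f (x - y) - f x‖ₑ ^ (2 : ℝ) ∂μ := by
    intro x
    have hmx : AEStronglyMeasurable (fun y ↦ f (x - y) - f x) μ :=
      (hf.1.comp_quasiMeasurePreserving
        (quasiMeasurePreserving_sub_left_of_right_invariant μ x)).sub aestronglyMeasurable_const
    have hmP : AEStronglyMeasurable (fun y ↦ f (x - y) - f x) P :=
      hmx.mono_ac (withDensity_absolutelyContinuous _ _)
    have hint : Integrable (fun y ↦ ρ.normed μ y • f (x - y)) μ := by
      have := ρ.hasCompactSupport_normed (μ := μ) |>.convolutionExists_left (lsmul ℝ ℝ) hρc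
        (hf.locallyIntegrable (by norm_num)) x
      simpa [ConvolutionExistsAt] using this
    have hconv : ((ρ.normed μ ⋆[lsmul ℝ ℝ, μ] f) - f) x =
        ∫ y, ρ.normed μ y • (f (x - y) - f x) ∂μ := by
      simp only [Pi.sub_apply, convolution_def, lsmul_apply, smul_sub]
      rw [integral_sub hint (ρ.integrable_normed.smul_const _), integral_smul_const,
        ρ.integral_normed, one_smul]
    have h1 : ‖((ρ.normed μ ⋆[lsmul ℝ ℝ, μ] f) - f) x‖ₑ ≤
        eLpNorm (fun y ↦ f (x - y) - f x) 1 P := by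
      rw [hconv, eLpNorm_one_eq_lintegral_enorm, hP,
        lintegral_withDensity_eq_lintegral_mul₀ hrm.aemeasurable hmx.enorm]
      refine (enorm_integral_le_lintegral_enorm _).trans (lintegral_mono fun y ↦ ?_)
      simp [enorm_smul, hr, Real.enorm_eq_ofReal (ρ.nonneg_normed y)]
    have h2 := h1.trans (eLpNorm_le_eLpNorm_of_exponent_le (q := 2) (by norm_num) hmP)
    have h3 : eLpNorm (fun y ↦ f (x - y) - f x) 2 P ^ (2 : ℝ) =
        ∫⁻ y, ‖f (x - y) - f x‖ₑ ^ (2 : ℝ) ∂P := by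
      have := eLpNorm_nnreal_pow_eq_lintegral (f := fun y ↦ f (x - y) - f x) (μ := P)
        (p := 2) (by norm_num)
      simpa using this
    refine (ENNReal.rpow_le_rpow h2 (by norm_num)).trans ?_
    rw [h3, hP, lintegral_withDensity_eq_lintegral_mul₀ hrm.aemeasurable
      (hmx.enorm.pow_const _)]
    simp
  have hsq : ∀ g : V → E, eLpNorm g 2 μ ^ (2 : ℝ) = ∫⁻ y, ‖g y‖ₑ ^ (2 : ℝ) ∂μ := fun g ↦ by
    have := eLpNorm_nnreal_pow_eq_lintegral (f := g) (μ := μ) (p := 2) (by norm_num)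
    simpa using this
  refine (ENNReal.rpow_le_rpow_iff (z := (2 : ℝ)) (by norm_num)).1 ?_
  rw [hsq]
  calc ∫⁻ x, ‖((ρ.normed μ ⋆[lsmul ℝ ℝ, μ] f) - f) x‖ₑ ^ (2 : ℝ) ∂μ
      ≤ ∫⁻ x, ∫⁻ y, r y * ‖f (x - y) - f x‖ₑ ^ (2 : ℝ) ∂μ ∂μ := lintegral_mono hpt
    _ = ∫⁻ y, ∫⁻ x, r y * ‖f (x - y) - f x‖ₑ ^ (2 : ℝ) ∂μ ∂μ :=
        lintegral_lintegral_swap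
          ((hrm.comp measurable_snd).aemeasurable.mul (hmeas.enorm.pow_const _))
    _ ≤ ∫⁻ y, r y * ε ^ (2 : ℝ) ∂μ := by
        refine lintegral_mono fun y ↦ ?_
        by_cases hy : ‖y‖ < ρ.rOut
        · rw [lintegral_const_mul' _ _ ENNReal.ofReal_ne_top, ← hsq fun x ↦ f (x - y) - f x]
          gcongr
          exact hε y hy
        · have : ρ.normed μ y = 0 := by
            rw [← Function.notMem_support, ρ.support_normed_eq]
            simpa using hy
          simp [hr, this]
    _ = ε ^ (2 : ℝ) := by rw [lintegral_mul_const _ hrm, hr1, one_mul]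

/-- Mollifications of an `L²` function converge to it in `L²`. -/
theorem tendsto_eLpNorm_normed_convolution_sub [CompleteSpace E] {ι : Type*} {l : Filter ι}
    {ρ : ι → ContDiffBump (0 : V)} (hρ : Tendsto (fun i ↦ (ρ i).rOut) l (𝓝 0)) {f : V → E}
    (hf : MemLp f 2 μ) :
    Tendsto (fun i ↦ eLpNorm (((ρ i).normed μ ⋆[lsmul ℝ ℝ, μ] f) - f) 2 μ) l (𝓝 0) := by
  rw [ENNReal.tendsto_nhds_zero]
  intro ε hε
  have h := (ENNReal.tendsto_nhds_zero.1 (tendsto_eLpNorm_comp_sub_sub_self hf)) ε hε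
  obtain ⟨δ, hδ, hball⟩ := Metric.eventually_nhds_iff.1 h
  filter_upwards [hρ.eventually (gt_mem_nhds hδ)] with i hi
  exact eLpNorm_normed_convolution_sub_le _ hf fun y hy ↦ hball (by simpa using hy.trans hi)

end Mollification

/-! ### Smooth approximation in H¹_loc. -/

section Mollification

open Filter Topology ContinuousLinearMap InnerProductSpace
open scoped Convolution ENNReal

variable {V : Type*} [NormedAddCommGroup V] [InnerProductSpace ℝ V] [FiniteDimensional ℝ V]
  [MeasureSpace V] [BorelSpace V] [(volume : Measure V).IsAddHaarMeasure]

/-- The gradient of a mollification of `v` is the mollification of the weak gradient of `v`, at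
points of `U` that are farther from the boundary than the radius of the mollifier. -/
theorem HasH1LocGradient.fderiv_normed_convolution {U : Set V} {v : V → ℝ} {G : V → V}
    (h : HasH1LocGradient U v G) (hU : MeasurableSet U) (ρ : ContDiffBump (0 : V)) {K : Set V}
    (hK : IsCompact K) (hKU : K ⊆ U) {x : V} (hx : Metric.closedBall x ρ.rOut ⊆ K) (e : V) :
    fderiv ℝ (ρ.normed volume ⋆[lsmul ℝ ℝ, volume] K.indicator v) x e =
      inner ℝ ((ρ.normed volume ⋆[lsmul ℝ ℝ, volume] K.indicator G) x) e := by
  set r := ρ.normed (volume : Measure V) with hr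
  have hrs : ContDiff ℝ ∞ r := ρ.contDiff_normed
  have hrc : HasCompactSupport r := ρ.hasCompactSupport_normed
  have hv2 : MemLp (K.indicator v) 2 := (memLp_indicator_iff_restrict hK.measurableSet).2
    (h.memLp_function K hKU hK)
  have hG2 : MemLp (K.indicator G) 2 := (memLp_indicator_iff_restrict hK.measurableSet).2
    (h.memLp_gradient K hKU hK)
  have hswap : (r ⋆[lsmul ℝ ℝ, volume] K.indicator v) =
      (K.indicator v ⋆[lsmul ℝ ℝ, volume] r) := by
    rw [← convolution_flip]
    congr 1
    ext
    simp
  -- The reflected bump centred at x serves as the test function in the definition of the weak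
  -- gradient; reflection produces the sign that integration by parts removes.
  let ψ : V → ℝ := fun y ↦ r (x - y)
  have hψd : ∀ y e, fderiv ℝ ψ y e = - fderiv ℝ r (x - y) e := fun y e ↦ by
    have h1 : HasFDerivAt ψ ((fderiv ℝ r (x - y)).comp (-ContinuousLinearMap.id ℝ V)) y :=
      ((hrs.differentiable (by simp)) (x - y)).hasFDerivAt.comp y ((hasFDerivAt_id y).const_sub x)
    rw [h1.fderiv]
    simp
  have hψs : Function.support ψ ⊆ Metric.closedBall x ρ.rOut := by
    intro y hy
    have : x - y ∈ Function.support r := hy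
    rw [hr, ρ.support_normed_eq, mem_ball_zero_iff, ← dist_eq_norm, dist_comm] at this
    exact this.le
  have hψt : tsupport ψ ⊆ Metric.closedBall x ρ.rOut :=
    closure_minimal hψs Metric.isClosed_closedBall
  have hψ : IsTestFunction U ψ :=
    ⟨hrs.comp (contDiff_const.sub contDiff_id),
      HasCompactSupport.of_support_subset_isCompact (isCompact_closedBall _ _) hψs,
      hψt.trans (hx.trans hKU)⟩
  have hoff : ∀ t ∉ K, ψ t = 0 := fun t ht ↦ by
    by_contra h0
    exact ht (hx (hψs h0))
  have hoffd : ∀ t ∉ K, ∀ e, fderiv ℝ ψ t e = 0 := fun t ht e ↦ by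
    have : t ∉ tsupport (fderiv ℝ ψ) := fun h' ↦ ht (hx (hψt (tsupport_fderiv_subset ℝ h')))
    simp [image_eq_zero_of_notMem_tsupport this]
  rw [hswap, (hrc.hasFDerivAt_convolution_right _ (hv2.locallyIntegrable (by norm_num))
    (hrs.of_le (by exact_mod_cast le_top)) x).fderiv, convolution_precompR_apply _
      (hv2.locallyIntegrable (by norm_num)) (hrc.fderiv ℝ) (hrs.continuous_fderiv (by simp))]
  have h1 : (K.indicator v ⋆[lsmul ℝ ℝ, volume] fun a ↦ fderiv ℝ r a e) x =
      - ∫ z in U, v z * fderiv ℝ ψ z e := by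
    rw [convolution_def, ← integral_neg, ← integral_indicator hU]
    refine integral_congr_ae (ae_of_all _ fun t ↦ ?_)
    by_cases ht : t ∈ K
    · simp [ht, hKU ht, hψd]
    · have := hoffd t ht e
      by_cases htU : t ∈ U <;> simp [ht, htU, this]
  have h2 : inner ℝ ((r ⋆[lsmul ℝ ℝ, volume] K.indicator G) x) e =
      ∫ z in U, ψ z * inner ℝ (G z) e := by
    have hint : Integrable (fun y ↦ r (x - y) • K.indicator G y) volume := by
      have := hrc.convolutionExists_right (lsmul ℝ ℝ).flip
        (hG2.locallyIntegrable (by norm_num)) hrs.continuous x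
      simpa [ConvolutionExistsAt] using this
    rw [convolution_lsmul_swap, real_inner_comm, ← integral_inner hint e,
      ← integral_indicator hU]
    refine integral_congr_ae (ae_of_all _ fun t ↦ ?_)
    by_cases ht : t ∈ K
    · simp [ht, hKU ht, ψ, real_inner_comm, inner_smul_right]
    · have := hoff t ht
      by_cases htU : t ∈ U <;> simp [ht, htU, this]
  rw [h1, h2, h.integral_eq ψ hψ e, neg_neg]

/-- Local approximation of a function in `H¹_loc(U)` by smooth functions. -/
theorem HasH1LocGradient.exists_contDiff_approx {U : Set V} {v : V → ℝ} {G : V → V}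
    (h : HasH1LocGradient U v G) (hU : IsOpen U) {K : Set V} (hK : IsCompact K) (hKU : K ⊆ U) :
    ∃ u : ℕ → V → ℝ, (∀ k, ContDiff ℝ ∞ (u k)) ∧
      (∀ᵐ z, z ∈ K → Tendsto (fun k ↦ u k z) atTop (𝓝 (v z))) ∧
      Tendsto (fun k ↦ eLpNorm (fun z ↦ gradient (u k) z - G z) 2 (volume.restrict K))
        atTop (𝓝 0) := by
  -- Room around `K`: truncating to the thickening makes v and G globally L², and mollification at
  -- radius at most δ does not see the truncation from points of `K`.
  obtain ⟨δ, hδ, hδU⟩ := hK.exists_cthickening_subset_open hU hKU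
  set K₁ := Metric.cthickening δ K
  have hK₁ : IsCompact K₁ := hK.cthickening
  have hv2 : MemLp (K₁.indicator v) 2 := (memLp_indicator_iff_restrict hK₁.measurableSet).2
    (h.memLp_function K₁ hδU hK₁)
  have hG2 : MemLp (K₁.indicator G) 2 := (memLp_indicator_iff_restrict hK₁.measurableSet).2
    (h.memLp_gradient K₁ hδU hK₁)
  -- The fixed ratio 2 of outer to inner radius is what pointwise convergence almost everywhere
  -- requires of the bumps.
  let ρ : ℕ → ContDiffBump (0 : V) := fun k ↦
    ⟨δ / (k + 1) / 2, δ / (k + 1), by positivity, half_lt_self (by positivity)⟩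
  have hρ : Tendsto (fun k ↦ (ρ k).rOut) atTop (𝓝 0) := by
    simpa [ρ, div_eq_mul_inv] using tendsto_one_div_add_atTop_nhds_zero_nat.const_mul δ
  have hρδ : ∀ k, (ρ k).rOut ≤ δ := fun k ↦
    div_le_self hδ.le (by have : (0 : ℝ) ≤ k := k.cast_nonneg
                          linarith)
  have hball : ∀ k, ∀ x ∈ K, Metric.closedBall x (ρ k).rOut ⊆ K₁ := fun k x hx ↦
    (Metric.closedBall_subset_closedBall (hρδ k)).trans (Metric.closedBall_subset_cthickening hx δ)
  refine ⟨fun k ↦ (ρ k).normed volume ⋆[lsmul ℝ ℝ, volume] K₁.indicator v, fun k ↦ ?_, ?_, ?_⟩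
  · exact (ρ k).hasCompactSupport_normed.contDiff_convolution_left _ (ρ k).contDiff_normed
      (hv2.locallyIntegrable (by norm_num))
  · filter_upwards [ContDiffBump.ae_convolution_tendsto_right_of_locallyIntegrable (K := 2) hρ
      (Eventually.of_forall fun k ↦ by simp only [ρ]; linarith)
      (hv2.locallyIntegrable (by norm_num))] with z hz hzK
    rwa [indicator_of_mem (Metric.self_subset_cthickening K hzK)] at hz
  · refine tendsto_of_tendsto_of_tendsto_of_le_of_le tendsto_const_nhds
      (tendsto_eLpNorm_normed_convolution_sub hρ hG2) (fun _ ↦ zero_le) fun k ↦ ?_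
    refine (eLpNorm_congr_ae ?_).trans_le (eLpNorm_mono_measure _ Measure.restrict_le_self)
    filter_upwards [ae_restrict_mem hK.measurableSet] with x hx
    rw [Pi.sub_apply, indicator_of_mem (Metric.self_subset_cthickening K hx)]
    congr 1
    refine ext_inner_right ℝ fun e ↦ ?_
    rw [gradient, toDual_symm_apply]
    exact h.fderiv_normed_convolution hU.measurableSet _ hK₁ hδU (hball k x hx) e

end Mollification

/-! ### Testing with nonlinear functions of v. -/

section Testing

open Filter Topology InnerProductSpace
open scoped ENNReal

variable {V : Type*} [NormedAddCommGroup V] [InnerProductSpace ℝ V]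

theorem integrable_inner_of_memLp_two {α : Type*} [MeasurableSpace α] {μ : Measure α}
    {f g : α → V} (hf : MemLp f 2 μ) (hg : MemLp g 2 μ) :
    Integrable (fun x ↦ (inner ℝ (f x) (g x) : ℝ)) μ :=
  memLp_one_iff_integrable.1 <| MemLp.of_bilin (p := 2) (q := 2) (r := 1)
    (fun x y : V ↦ (inner ℝ x y : ℝ)) 1 hf hg (hf.1.inner hg.1)
    (ae_of_all _ fun x ↦ by simpa using nnnorm_inner_le_nnnorm (𝕜 := ℝ) (f x) (g x))

/-- Cauchy–Schwarz. The coefficients need only a common bound, not convergence; this suits Φ'(u_k)η²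
multiplied by the gradient error. -/
theorem tendsto_integral_mul_inner_of_eLpNorm {α : Type*} [MeasurableSpace α] {μ : Measure α}
    {ι : Type*} {l : Filter ι} {a : ι → α → ℝ} {H : ι → α → V} {A : α → V} {c : ℝ}
    (ha : ∀ i x, |a i x| ≤ c) (hHm : ∀ i, AEStronglyMeasurable (H i) μ) (hA : MemLp A 2 μ)
    (hH : Tendsto (fun i ↦ eLpNorm (H i) 2 μ) l (𝓝 0)) :
    Tendsto (fun i ↦ ∫ x, a i x * inner ℝ (H i x) (A x) ∂μ) l (𝓝 0) := by
  have hlim : Tendsto (fun i ↦ ENNReal.ofReal c * (eLpNorm (H i) 2 μ * eLpNorm A 2 μ)) l (𝓝 0) := by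
    have := ENNReal.Tendsto.const_mul (ENNReal.Tendsto.mul_const hH (Or.inr hA.2.ne))
      (Or.inr (ENNReal.ofReal_ne_top (r := c)))
    simpa using this
  rw [tendsto_zero_iff_enorm_tendsto_zero]
  refine tendsto_of_tendsto_of_tendsto_of_le_of_le tendsto_const_nhds hlim (fun _ ↦ zero_le)
    fun i ↦ ?_
  calc ‖∫ x, a i x * inner ℝ (H i x) (A x) ∂μ‖ₑ
      ≤ ∫⁻ x, ‖a i x * inner ℝ (H i x) (A x)‖ₑ ∂μ := enorm_integral_le_lintegral_enorm _
    _ ≤ ∫⁻ x, ENNReal.ofReal c * ‖inner ℝ (H i x) (A x)‖ₑ ∂μ := by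
        refine lintegral_mono fun x ↦ ?_
        rw [enorm_mul]
        gcongr
        rw [Real.enorm_eq_ofReal_abs]
        exact ENNReal.ofReal_le_ofReal (ha i x)
    _ = ENNReal.ofReal c * eLpNorm (fun x ↦ inner ℝ (H i x) (A x)) 1 μ := by
        rw [lintegral_const_mul' _ _ ENNReal.ofReal_ne_top, eLpNorm_one_eq_lintegral_enorm]
    _ ≤ ENNReal.ofReal c * (eLpNorm (H i) 2 μ * eLpNorm A 2 μ) := by
        gcongr
        simpa using eLpNorm_le_eLpNorm_mul_eLpNorm'_of_norm (p := 2) (q := 2) (r := 1) (hHm i) hA.1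
          (fun x y : V ↦ (inner ℝ x y : ℝ)) 1
          (ae_of_all _ fun x ↦ by simpa using norm_inner_le_norm (𝕜 := ℝ) (H i x) (A x))

variable [FiniteDimensional ℝ V] [MeasureSpace V] [BorelSpace V]
  [(volume : Measure V).IsAddHaarMeasure]

/-- A weak differential inequality `- div A + v ≤ 0` may be tested with `Φ(v) η²`, where `v` is in
`H¹_loc` with weak gradient `G`. -/
theorem HasH1LocGradient.integral_le_zero_of_weak_le {U : Set V} {v : V → ℝ} {A G : V → V}
    (h : HasH1LocGradient U v G) (hU : IsOpen U)
    (hA : ∀ K : Set V, K ⊆ U → IsCompact K → MemLp A 2 (volume.restrict K))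
    (hweak : ∀ φ : V → ℝ, IsTestFunction U φ → (∀ z, 0 ≤ φ z) →
      ∫ z in U, (fderiv ℝ φ z (A z) + v z * φ z) ≤ 0)
    {Φ : ℝ → ℝ} {c : ℝ} (hΦ : ContDiff ℝ ∞ Φ) (hΦ0 : ∀ t, 0 ≤ Φ t) (hΦc : ∀ t, |Φ t| ≤ c)
    (hΦ'c : ∀ t, |deriv Φ t| ≤ c) {η : V → ℝ} (hη : IsTestFunction U η) :
    IntegrableOn (fun z ↦ deriv Φ (v z) * η z ^ 2 * inner ℝ (G z) (A z) +
      2 * Φ (v z) * η z * fderiv ℝ η z (A z) + v z * Φ (v z) * η z ^ 2) U ∧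
    ∫ z in U, (deriv Φ (v z) * η z ^ 2 * inner ℝ (G z) (A z) +
      2 * Φ (v z) * η z * fderiv ℝ η z (A z) + v z * Φ (v z) * η z ^ 2) ≤ 0 := by
  set K := tsupport η with hKdef
  have hK : IsCompact K := hη.compactSupport
  have hKU : K ⊆ U := hη.support_subset
  obtain ⟨u, hu, hulim, hugrad⟩ := h.exists_contDiff_approx hU hK hKU
  set μ : Measure V := volume.restrict K with hμ
  have : IsFiniteMeasure μ := ⟨by rw [hμ, Measure.restrict_apply_univ]; exact hK.measure_lt_top⟩
  have hc : 0 ≤ c := (abs_nonneg _).trans (hΦc 0)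
  have hvK := h.memLp_function K hKU hK
  have hGK := h.memLp_gradient K hKU hK
  have hAK := hA K hKU hK
  have hηc : Continuous η := hη.smooth.continuous
  have hη'c : Continuous (fderiv ℝ η) := hη.smooth.continuous_fderiv (by simp)
  obtain ⟨M, hM⟩ : ∃ M, ∀ z, ‖η z‖ ≤ M := hηc.bounded_above_of_compact_support hη.compactSupport
  obtain ⟨M', hM'⟩ : ∃ M, ∀ z, ‖fderiv ℝ η z‖ ≤ M :=
    hη'c.bounded_above_of_compact_support (hη.compactSupport.fderiv ℝ)
  have hM0 : 0 ≤ M := (norm_nonneg _).trans (hM 0)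
  have hΦd : Continuous (deriv Φ) := hΦ.continuous_deriv (by simp)
  have hη2 : ∀ z, |η z ^ 2| ≤ M ^ 2 := fun z ↦ by
    rw [abs_pow]
    exact pow_le_pow_left₀ (abs_nonneg _) (hM z) 2
  have hres : ∀ f : V → ℝ, (∀ z ∉ K, f z = 0) → ∫ z in U, f z = ∫ z, f z ∂μ := fun f hf ↦
    setIntegral_eq_of_subset_of_forall_sdiff_eq_zero hU.measurableSet hKU fun z hz ↦ hf z hz.2
  have hη0 : ∀ z ∉ K, η z = 0 := fun z hz ↦ image_eq_zero_of_notMem_tsupport hz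
  have hAη : AEStronglyMeasurable (fun z ↦ fderiv ℝ η z (A z)) μ :=
    ((ContinuousLinearMap.id ℝ (V →L[ℝ] ℝ)).aestronglyMeasurable_comp₂
      hη'c.aestronglyMeasurable hAK.1)
  -- the part of the tested inequality in which only values of the approximations occur
  let F : (V → ℝ) → V → ℝ := fun w z ↦ deriv Φ (w z) * η z ^ 2 * inner ℝ (G z) (A z) +
      2 * Φ (w z) * η z * fderiv ℝ η z (A z) + v z * Φ (w z) * η z ^ 2
  have hGA : Integrable (fun z ↦ inner ℝ (G z) (A z)) μ :=
    integrable_inner_of_memLp_two hGK hAK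
  have hFm : ∀ w : V → ℝ, AEStronglyMeasurable w μ → AEStronglyMeasurable (F w) μ := by
    intro w hw
    have h1 := hΦd.comp_aestronglyMeasurable hw
    have h2 := hΦ.continuous.comp_aestronglyMeasurable hw
    have h3 : AEStronglyMeasurable η μ := hηc.aestronglyMeasurable
    exact (((h1.mul (h3.pow 2)).mul hGA.1).add (((h2.const_mul 2).mul h3).mul hAη)).add
      ((hvK.1.mul h2).mul (h3.pow 2))
  -- The bound is independent of `w` because Φ and Φ' are bounded, so one function dominates the
  -- whole approximating sequence.
  let b : V → ℝ := fun z ↦ c * M ^ 2 * ‖(inner ℝ (G z) (A z) : ℝ)‖ +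
    2 * c * M * (M' * ‖A z‖) + ‖v z‖ * c * M ^ 2
  have hb : Integrable b μ :=
    ((hGA.norm.const_mul _).add (((hAK.integrable (by norm_num)).norm.const_mul M').const_mul
      _)).add (((hvK.integrable (by norm_num)).norm.mul_const _).mul_const _)
  have hFb : ∀ w : V → ℝ, ∀ z, ‖F w z‖ ≤ b z := by
    intro w z
    refine (norm_add₃_le).trans (add_le_add (add_le_add ?_ ?_) ?_)
    · rw [norm_mul, norm_mul]
      gcongr
      · exact hΦ'c _
      · exact hη2 z
    · rw [norm_mul, norm_mul, norm_mul, Real.norm_ofNat]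
      gcongr
      · exact hΦc _
      · exact hM z
      · exact (ContinuousLinearMap.le_opNorm _ _).trans (by gcongr; exact hM' z)
    · rw [norm_mul, norm_mul]
      gcongr
      · exact hΦc _
      · exact hη2 z
  have hF0 : ∀ z ∉ K, F v z = 0 := fun z hz ↦ by simp [F, hη0 z hz]
  have hFvU : IntegrableOn (F v) U :=
    IntegrableOn.of_forall_sdiff_eq_zero (s := K)
      (hb.mono' (hFm v hvK.1) (ae_of_all _ (hFb v))) hU.measurableSet fun z hz ↦ hF0 z hz.2
  refine ⟨hFvU, ?_⟩
  have hum : ∀ k, AEStronglyMeasurable (u k) μ := fun k ↦ (hu k).continuous.aestronglyMeasurable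
  have hFint : ∀ k, Integrable (F (u k)) μ := fun k ↦
    hb.mono' (hFm _ (hum k)) (ae_of_all _ (hFb _))
  have hlim1 : Tendsto (fun k ↦ ∫ z, F (u k) z ∂μ) atTop (𝓝 (∫ z, F v z ∂μ)) := by
    refine tendsto_integral_of_dominated_convergence b (fun k ↦ hFm _ (hum k)) hb
      (fun k ↦ ae_of_all _ (hFb _)) ?_
    filter_upwards [ae_restrict_of_ae hulim, ae_restrict_mem hK.measurableSet] with z hz hzK
    have h1 : Tendsto (fun k ↦ deriv Φ (u k z)) atTop (𝓝 (deriv Φ (v z))) :=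
      (hΦd.tendsto _).comp (hz hzK)
    have h2 : Tendsto (fun k ↦ Φ (u k z)) atTop (𝓝 (Φ (v z))) :=
      (hΦ.continuous.tendsto _).comp (hz hzK)
    exact (((h1.mul_const _).mul_const _).add (((h2.const_mul 2).mul_const _).mul_const _)).add
      ((h2.const_mul (v z)).mul_const _)
  have hgc : ∀ k, Continuous (gradient (u k)) := fun k ↦
    (toDual ℝ V).symm.continuous.comp ((hu k).continuous_fderiv (by simp))
  have hcoef : ∀ k z, |deriv Φ (u k z) * η z ^ 2| ≤ c * M ^ 2 := fun k z ↦ by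
    rw [abs_mul]
    exact mul_le_mul (hΦ'c _) (hη2 z) (abs_nonneg _) hc
  -- `F (u k)` contains G where testing with Φ(u_k)η² produces ∇u_k; this is the resulting error.
  -- Passing to the limit in it separately avoids a chain rule for Φ(v).
  have hlim2 := tendsto_integral_mul_inner_of_eLpNorm
    (a := fun k z ↦ deriv Φ (u k z) * η z ^ 2) hcoef
    (fun k ↦ (hgc k).aestronglyMeasurable.sub hGK.1) hAK hugrad
  have hlim := hlim1.add hlim2
  simp only [Pi.sub_apply] at hlim
  rw [add_zero] at hlim
  rw [hres (F v) hF0]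
  refine le_of_tendsto hlim (Eventually.of_forall fun k ↦ ?_)
  set φ : V → ℝ := fun z ↦ Φ (u k z) * η z ^ 2 with hφ
  have hφ0 : ∀ z ∉ K, φ z = 0 := fun z hz ↦ by simp [hφ, hη0 z hz]
  have hφs : Function.support φ ⊆ K := fun z hz ↦ by_contra fun h' ↦ hz (hφ0 z h')
  have hφt : IsTestFunction U φ :=
    ⟨(hΦ.comp (hu k)).mul (hη.smooth.pow 2),
      HasCompactSupport.of_support_subset_isCompact hK hφs,
      (closure_minimal hφs hK.isClosed).trans hKU⟩
  have hφd : ∀ z e, fderiv ℝ φ z e = deriv Φ (u k z) * η z ^ 2 * fderiv ℝ (u k) z e +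
      2 * Φ (u k z) * η z * fderiv ℝ η z e := by
    intro z e
    have h1 : HasFDerivAt (fun z ↦ Φ (u k z)) (deriv Φ (u k z) • fderiv ℝ (u k) z) z :=
      ((hΦ.differentiable (by simp)) _).hasDerivAt.comp_hasFDerivAt z
        (((hu k).differentiable (by simp)) z).hasFDerivAt
    have h2 := h1.mul (((hη.smooth.differentiable (by simp)) z).hasFDerivAt.pow 2)
    have h3 : fderiv ℝ φ z = _ := h2.fderiv
    rw [h3]
    simp
    ring
  have hw := hweak φ hφt fun z ↦ mul_nonneg (hΦ0 _) (sq_nonneg _)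
  rw [hres _ fun z hz ↦ by rw [hφd, hφ0 z hz]; simp [hη0 z hz]] at hw
  have hDint : Integrable (fun z ↦ deriv Φ (u k z) * η z ^ 2 *
      inner ℝ (gradient (u k) z - G z) (A z)) μ := by
    obtain ⟨B, hB⟩ := hK.exists_bound_of_continuousOn (hgc k).continuousOn
    have hD : MemLp (fun z ↦ gradient (u k) z - G z) 2 μ :=
      (MemLp.of_bound (hgc k).aestronglyMeasurable B
        ((ae_restrict_mem hK.measurableSet).mono hB)).sub hGK
    exact (integrable_inner_of_memLp_two hD hAK).bdd_mul
      (((hΦd.comp (hu k).continuous).mul (hηc.pow 2)).aestronglyMeasurable)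
      (ae_of_all _ (hcoef k))
  rw [← integral_add (hFint k) hDint]
  refine le_of_eq_of_le (integral_congr_ae (ae_of_all _ fun z ↦ ?_)) hw
  have : fderiv ℝ (u k) z (A z) = inner ℝ (gradient (u k) z) (A z) := by
    rw [gradient, toDual_symm_apply]
  simp only [F, hφd, this, inner_sub_left]
  simp only [hφ]
  ring

end Testing

/-! ### Splitting off the last coordinate. -/

noncomputable section Slicing

open Filter Topology

variable {n : ℕ}

/-- The last coordinate as a continuous linear functional. -/
def lastCoord (n : ℕ) : EuclideanSpace ℝ (Fin (n + 1)) →L[ℝ] ℝ :=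
  EuclideanSpace.proj (Fin.last n)

/-- The first `n` coordinates as a continuous linear map. -/
def initCoord (n : ℕ) : EuclideanSpace ℝ (Fin (n + 1)) →L[ℝ] (Fin n → ℝ) :=
  ContinuousLinearMap.pi fun i ↦ EuclideanSpace.proj ((Fin.last n).succAbove i)

/-- The last vector of the standard basis. -/
def lastVec (n : ℕ) : EuclideanSpace ℝ (Fin (n + 1)) := EuclideanSpace.single (Fin.last n) 1

/-- The inclusion of `ℝⁿ` as the hyperplane on which the last coordinate vanishes. -/
def horizontal (n : ℕ) : (Fin n → ℝ) →L[ℝ] EuclideanSpace ℝ (Fin (n + 1)) :=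
  LinearMap.toContinuousLinearMap
    { toFun := fun y ↦ WithLp.toLp 2 ((Fin.last n).insertNth 0 y)
      map_add' := fun x y ↦ by
        ext i
        refine (Fin.last n).succAboveCases ?_ (fun j ↦ ?_) i <;> simp
      map_smul' := fun c y ↦ by
        ext i
        refine (Fin.last n).succAboveCases ?_ (fun j ↦ ?_) i <;> simp }

theorem horizontal_apply (y : Fin n → ℝ) :
    horizontal n y = WithLp.toLp 2 ((Fin.last n).insertNth 0 y) := rfl

theorem horizontal_add_smul_lastVec (y : Fin n → ℝ) (t : ℝ) :
    horizontal n y + t • lastVec n = WithLp.toLp 2 ((Fin.last n).insertNth t y) := by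
  ext i
  refine (Fin.last n).succAboveCases ?_ (fun j ↦ ?_) i <;>
    simp [horizontal_apply, lastVec]

@[simp]
theorem horizontal_last (y : Fin n → ℝ) : horizontal n y (Fin.last n) = 0 := by
  simp [horizontal_apply]

@[simp]
theorem lastVec_last : lastVec n (Fin.last n) = 1 := by
  simp [lastVec]

theorem horizontal_add_smul_lastVec_last (y : Fin n → ℝ) (t : ℝ) :
    (horizontal n y + t • lastVec n) (Fin.last n) = t := by
  simp [horizontal_add_smul_lastVec]

@[simp]
theorem initCoord_horizontal_add (y : Fin n → ℝ) (t : ℝ) :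
    initCoord n (horizontal n y + t • lastVec n) = y := by
  ext i
  simp [horizontal_add_smul_lastVec, initCoord]

theorem horizontal_initCoord_add (z : EuclideanSpace ℝ (Fin (n + 1))) :
    horizontal n (initCoord n z) + z (Fin.last n) • lastVec n = z := by
  rw [horizontal_add_smul_lastVec]
  ext i
  refine (Fin.last n).succAboveCases ?_ (fun j ↦ ?_) i <;> simp [initCoord]

/-- The identification of `ℝ × ℝⁿ` with `ℝⁿ⁺¹`. -/
def sliceEquiv (n : ℕ) : ℝ × (Fin n → ℝ) ≃ᵐ EuclideanSpace ℝ (Fin (n + 1)) :=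
  (MeasurableEquiv.piFinSuccAbove (fun _ ↦ ℝ) (Fin.last n)).symm.trans
    (MeasurableEquiv.toLp 2 (Fin (n + 1) → ℝ))

theorem sliceEquiv_apply (p : ℝ × (Fin n → ℝ)) :
    sliceEquiv n p = horizontal n p.2 + p.1 • lastVec n := by
  rw [horizontal_add_smul_lastVec]
  rfl

theorem measurePreserving_sliceEquiv : MeasurePreserving (sliceEquiv n) :=
  (PiLp.volume_preserving_toLp (Fin (n + 1))).comp
    (volume_preserving_piFinSuccAbove (fun _ ↦ ℝ) (Fin.last n)).symm

theorem measurableSet_halfSpace (a : ℝ) : MeasurableSet (halfSpace n a) :=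
  measurableSet_lt measurable_const (lastCoord n).continuous.measurable

theorem isOpen_halfSpace (a : ℝ) : IsOpen (halfSpace n a) :=
  isOpen_lt continuous_const (lastCoord n).continuous

theorem measurePreserving_sliceEquiv_restrict (a : ℝ) :
    MeasurePreserving (sliceEquiv n) ((volume.restrict (Ioi a)).prod volume)
      (volume.restrict (halfSpace n a)) := by
  have h := measurePreserving_sliceEquiv.restrict_preimage (measurableSet_halfSpace (n := n) a)
  have hpre : sliceEquiv n ⁻¹' halfSpace n a = Ioi a ×ˢ univ := by
    ext p
    rw [mem_preimage, sliceEquiv_apply]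
    simp only [halfSpace, mem_ofPred_eq, horizontal_add_smul_lastVec_last]
    simp
  rwa [hpre, Measure.volume_eq_prod, ← Measure.prod_restrict, Measure.restrict_univ] at h

/-- Inner integration over horizontal hyperplanes, suited to horizontal derivatives; the swapped
version integrates along vertical lines, where the one-dimensional weak formulations apply. -/
theorem setIntegral_halfSpace_eq {a : ℝ} {f : EuclideanSpace ℝ (Fin (n + 1)) → ℝ}
    (hf : IntegrableOn f (halfSpace n a)) :
    ∫ z in halfSpace n a, f z = ∫ t in Ioi a, ∫ y, f (horizontal n y + t • lastVec n) := by
  have hmp := measurePreserving_sliceEquiv_restrict (n := n) a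
  rw [← hmp.integral_comp', integral_prod]
  · simp_rw [sliceEquiv_apply]
  · exact (hmp.integrable_comp_emb (sliceEquiv n).measurableEmbedding).2 hf

theorem setIntegral_halfSpace_eq_swap {a : ℝ} {f : EuclideanSpace ℝ (Fin (n + 1)) → ℝ}
    (hf : IntegrableOn f (halfSpace n a)) :
    ∫ z in halfSpace n a, f z = ∫ y, ∫ t in Ioi a, f (horizontal n y + t • lastVec n) := by
  have hmp := measurePreserving_sliceEquiv_restrict (n := n) a
  rw [← hmp.integral_comp', integral_prod_symm]
  · simp_rw [sliceEquiv_apply]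
  · exact (hmp.integrable_comp_emb (sliceEquiv n).measurableEmbedding).2 hf

theorem quasiMeasurePreserving_last (a : ℝ) :
    Measure.QuasiMeasurePreserving (fun z : EuclideanSpace ℝ (Fin (n + 1)) ↦ z (Fin.last n))
      (volume.restrict (halfSpace n a)) (volume.restrict (Ioi a)) := by
  have h := Measure.quasiMeasurePreserving_fst (μ := volume.restrict (Ioi a))
    (ν := (volume : Measure (Fin n → ℝ)))
  have h2 := h.comp ((measurePreserving_sliceEquiv_restrict (n := n) a).symm
    (sliceEquiv n)).quasiMeasurePreserving
  have h3 : (Prod.fst ∘ (sliceEquiv n).symm) = fun z ↦ z (Fin.last n) := by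
    ext z
    obtain ⟨p, rfl⟩ := (sliceEquiv n).surjective z
    rw [Function.comp_apply, MeasurableEquiv.symm_apply_apply, sliceEquiv_apply,
      horizontal_add_smul_lastVec_last]
  rwa [h3] at h2

/-- Functions of the last coordinate inherit local square integrability. -/
theorem memLp_comp_last {F : Type*} [NormedAddCommGroup F] {a : ℝ} {w : ℝ → F}
    (hw : ∀ K : Set ℝ, K ⊆ Ioi a → IsCompact K → MemLp w 2 (volume.restrict K))
    {K : Set (EuclideanSpace ℝ (Fin (n + 1)))} (hKU : K ⊆ halfSpace n a) (hK : IsCompact K) :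
    MemLp (fun z : EuclideanSpace ℝ (Fin (n + 1)) ↦ w (z (Fin.last n))) 2
      (volume.restrict K) := by
  -- `K` lies in the box with sides `I` and `J`, on which a function of the vertical variable is L²
  -- because `J` has finite measure.
  set I := lastCoord n '' K
  set J := initCoord n '' K
  have hI : IsCompact I := hK.image (lastCoord n).continuous
  have hJ : IsCompact J := hK.image (initCoord n).continuous
  have hIa : I ⊆ Ioi a := by
    rintro _ ⟨z, hz, rfl⟩
    exact hKU hz
  have : IsFiniteMeasure ((volume : Measure (Fin n → ℝ)).restrict J) :=
    ⟨by rw [Measure.restrict_apply_univ]; exact hJ.measure_lt_top⟩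
  have h1 : MemLp (fun p : ℝ × (Fin n → ℝ) ↦ w p.1) 2
      ((volume.restrict I).prod (volume.restrict J)) := (hw I hIa hI).comp_fst _
  rw [Measure.prod_restrict] at h1
  have hpre : sliceEquiv n ⁻¹' K ⊆ I ×ˢ J := by
    intro p hp
    refine ⟨⟨_, hp, ?_⟩, ⟨_, hp, ?_⟩⟩ <;> rw [sliceEquiv_apply]
    · exact horizontal_add_smul_lastVec_last _ _
    · exact initCoord_horizontal_add _ _
  have hmp := ((measurePreserving_sliceEquiv (n := n)).restrict_preimage hK.measurableSet).symm
  have h2 := (h1.mono_measure (Measure.restrict_mono hpre le_rfl)).comp_measurePreserving hmp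
  refine h2.ae_eq (ae_of_all _ fun z ↦ ?_)
  obtain ⟨p, rfl⟩ := (sliceEquiv n).surjective z
  rw [Function.comp_apply, MeasurableEquiv.symm_apply_apply, sliceEquiv_apply]
  exact congrArg w (horizontal_add_smul_lastVec_last _ _).symm

end Slicing

/-! ### Lifting from the half-line to the half-space. -/

section Lifting

open Filter Topology

theorem fderiv_eq_zero_of_notMem_tsupport {V : Type*} [NormedAddCommGroup V] [NormedSpace ℝ V]
    {φ : V → ℝ} {z : V} (hz : z ∉ tsupport φ) : fderiv ℝ φ z = 0 :=
  image_eq_zero_of_notMem_tsupport fun h ↦ hz (tsupport_fderiv_subset ℝ h)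

/-- The product of a locally square integrable function and a bounded measurable function that
vanishes off a compact set is integrable. -/
theorem integrableOn_mul_of_memLp_two {V : Type*} [NormedAddCommGroup V] [MeasureSpace V]
    [OpensMeasurableSpace V] [IsFiniteMeasureOnCompacts (volume : Measure V)]
    {U K : Set V} {f g : V → ℝ} {c : ℝ}
    (hU : MeasurableSet U) (hK : IsCompact K) (hf : MemLp f 2 (volume.restrict K))
    (hgm : AEStronglyMeasurable g (volume.restrict K)) (hgc : ∀ z, |g z| ≤ c)
    (hg0 : ∀ z ∉ K, g z = 0) :
    IntegrableOn (fun z ↦ f z * g z) U := by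
  have : IsFiniteMeasure ((volume : Measure V).restrict K) :=
    ⟨by rw [Measure.restrict_apply_univ]; exact hK.measure_lt_top⟩
  have h : IntegrableOn (fun z ↦ f z * g z) K :=
    (hf.integrable (by norm_num)).mul_bdd hgm (ae_of_all _ hgc)
  exact h.of_forall_sdiff_eq_zero hU fun z hz ↦ by simp [hg0 z hz.2]

variable {n : ℕ} {a : ℝ} {φ : EuclideanSpace ℝ (Fin (n + 1)) → ℝ}

theorem hasFDerivAt_comp_slice (hφ : Differentiable ℝ φ) (y : Fin n → ℝ) (t : ℝ) :
    HasFDerivAt (fun s : ℝ ↦ φ (horizontal n y + s • lastVec n))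
      ((fderiv ℝ φ (horizontal n y + t • lastVec n)).comp
        (ContinuousLinearMap.toSpanSingleton ℝ (lastVec n))) t := by
  refine (hφ _).hasFDerivAt.comp t ?_
  exact ((ContinuousLinearMap.toSpanSingleton ℝ (lastVec n)).hasFDerivAt).const_add _

theorem hasFDerivAt_comp_horizontal (hφ : Differentiable ℝ φ) (y : Fin n → ℝ) (t : ℝ) :
    HasFDerivAt (fun x : Fin n → ℝ ↦ φ (horizontal n x + t • lastVec n))
      ((fderiv ℝ φ (horizontal n y + t • lastVec n)).comp (horizontal n)) y :=
  (hφ _).hasFDerivAt.comp y ((horizontal n).hasFDerivAt.add_const _)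

theorem IsTestFunction.slice (hφ : IsTestFunction (halfSpace n a) φ) (y : Fin n → ℝ) :
    IsTestFunction (Ioi a) (fun s : ℝ ↦ φ (horizontal n y + s • lastVec n)) := by
  set I := lastCoord n '' tsupport φ with hI
  have hIc : IsCompact I := IsCompact.image hφ.compactSupport (lastCoord n).continuous
  have hs : Function.support (fun s : ℝ ↦ φ (horizontal n y + s • lastVec n)) ⊆ I := by
    intro s hs
    exact ⟨_, subset_tsupport _ hs, horizontal_add_smul_lastVec_last _ _⟩
  refine ⟨hφ.smooth.comp (contDiff_const.add (contDiff_id.smul contDiff_const)),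
    HasCompactSupport.of_support_subset_isCompact hIc hs,
    (closure_minimal hs hIc.isClosed).trans ?_⟩
  rintro _ ⟨z, hz, rfl⟩
  exact hφ.support_subset hz

theorem integral_fderiv_eq_zero_of_hasCompactSupport {E : Type*} [NormedAddCommGroup E]
    [NormedSpace ℝ E] [FiniteDimensional ℝ E] [MeasurableSpace E] [BorelSpace E] {μ : Measure E}
    [μ.IsAddHaarMeasure] {f : E → ℝ} (hf : ContDiff ℝ 1 f) (hc : HasCompactSupport f) (q : E) :
    ∫ x, fderiv ℝ f x q ∂μ = 0 := by
  have h1 : Integrable (fun x ↦ fderiv ℝ f x q) μ :=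
    ((hf.continuous_fderiv one_ne_zero).clm_apply continuous_const).integrable_of_hasCompactSupport
      (hc.fderiv_apply (𝕜 := ℝ) q)
  have h := integral_mul_fderiv_eq_neg_fderiv_mul_of_integrable (μ := μ) (f := fun _ : E ↦ (1 : ℝ))
    (g := f) (v := q) (by simp) (by simpa using h1)
    (by simpa using hf.continuous.integrable_of_hasCompactSupport hc)
    (fun _ _ ↦ differentiableAt_const _) (fun x _ ↦ hf.differentiable one_ne_zero x)
  simpa using h

/-- A horizontal slice of a test function has compact support. Consequently a function of the last
coordinate has no horizontal weak derivative. -/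
theorem integral_fderiv_horizontal_eq_zero (hφ : IsTestFunction (halfSpace n a) φ)
    (q : Fin n → ℝ) (t : ℝ) :
    ∫ y, fderiv ℝ φ (horizontal n y + t • lastVec n) (horizontal n q) = 0 := by
  have hd := hφ.smooth.differentiable (by simp)
  have hJ : IsCompact (initCoord n '' tsupport φ) :=
    IsCompact.image hφ.compactSupport (initCoord n).continuous
  have h := integral_fderiv_eq_zero_of_hasCompactSupport (μ := volume)
    (f := fun x : Fin n → ℝ ↦ φ (horizontal n x + t • lastVec n))
    ((hφ.smooth.of_le (by exact_mod_cast le_top)).comp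
      ((horizontal n).contDiff.add contDiff_const))
    (HasCompactSupport.of_support_subset_isCompact hJ fun y hy ↦
      ⟨_, subset_tsupport _ hy, initCoord_horizontal_add _ _⟩) q
  rw [← h]
  refine integral_congr_ae (ae_of_all _ fun y ↦ ?_)
  simp only [(hasFDerivAt_comp_horizontal hd y t).fderiv, ContinuousLinearMap.comp_apply]

theorem IsTestFunction.exists_bound {V : Type*} [NormedAddCommGroup V] [InnerProductSpace ℝ V]
    {U : Set V} {φ : V → ℝ} (hφ : IsTestFunction U φ) :
    ∃ c, ∀ z, ‖φ z‖ ≤ c :=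
  hφ.smooth.continuous.bounded_above_of_compact_support hφ.compactSupport

theorem IsTestFunction.continuous_fderiv {V : Type*} [NormedAddCommGroup V]
    [InnerProductSpace ℝ V] {U : Set V} {φ : V → ℝ} (hφ : IsTestFunction U φ) :
    Continuous (fderiv ℝ φ) :=
  hφ.smooth.continuous_fderiv (by simp)

theorem IsTestFunction.exists_bound_fderiv {V : Type*} [NormedAddCommGroup V]
    [InnerProductSpace ℝ V] {U : Set V} {φ : V → ℝ} (hφ : IsTestFunction U φ) :
    ∃ c, ∀ z, ‖fderiv ℝ φ z‖ ≤ c :=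
  hφ.continuous_fderiv.bounded_above_of_compact_support (hφ.compactSupport.fderiv ℝ)

theorem integrableOn_mul_testFunction (hφ : IsTestFunction (halfSpace n a) φ)
    {w : EuclideanSpace ℝ (Fin (n + 1)) → ℝ}
    (hw : MemLp w 2 (volume.restrict (tsupport φ))) :
    IntegrableOn (fun z ↦ w z * φ z) (halfSpace n a) := by
  obtain ⟨c, hc⟩ := hφ.exists_bound
  exact integrableOn_mul_of_memLp_two (measurableSet_halfSpace a) hφ.compactSupport
    hw hφ.smooth.continuous.aestronglyMeasurable hc
    fun z hz ↦ image_eq_zero_of_notMem_tsupport hz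

theorem integrableOn_mul_fderiv_testFunction (hφ : IsTestFunction (halfSpace n a) φ)
    {w : EuclideanSpace ℝ (Fin (n + 1)) → ℝ}
    (hw : MemLp w 2 (volume.restrict (tsupport φ))) (e : EuclideanSpace ℝ (Fin (n + 1))) :
    IntegrableOn (fun z ↦ w z * fderiv ℝ φ z e) (halfSpace n a) := by
  obtain ⟨c, hc⟩ := hφ.exists_bound_fderiv
  refine integrableOn_mul_of_memLp_two (c := c * ‖e‖) (measurableSet_halfSpace a)
    hφ.compactSupport hw
    (hφ.continuous_fderiv.clm_apply continuous_const).aestronglyMeasurable (fun z ↦ ?_)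
    fun z hz ↦ by simp [fderiv_eq_zero_of_notMem_tsupport hz]
  exact ((fderiv ℝ φ z).le_opNorm e).trans
    (mul_le_mul_of_nonneg_right (hc z) (norm_nonneg e))

/-- A function of the last coordinate is in `H¹_loc` of a half-space if it is in `H¹_loc` of the
corresponding half-line. -/
theorem HasH1LocGradient.comp_last {w w' : ℝ → ℝ} (h : HasH1LocGradient (Ioi a) w w') :
    HasH1LocGradient (halfSpace n a) (fun z ↦ w (z (Fin.last n)))
      (fun z ↦ w' (z (Fin.last n)) • lastVec n) := by
  have hW := fun K hKU hK ↦ memLp_comp_last (n := n) (K := K) h.memLp_function hKU hK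
  have hW' := fun K hKU hK ↦ memLp_comp_last (n := n) (K := K) h.memLp_gradient hKU hK
  refine ⟨hW, fun K hKU hK ↦ ?_, fun φ hφ e ↦ ?_⟩
  · exact (ContinuousLinearMap.toSpanSingleton ℝ (lastVec n)).comp_memLp' (hW' K hKU hK)
  · have hWφ := hW _ hφ.support_subset hφ.compactSupport
    have hWφ' := hW' _ hφ.support_subset hφ.compactSupport
    have hd := hφ.smooth.differentiable (by simp)
    -- The direction splits as horizontal part plus s times the last basis vector. The horizontal
    -- part contributes nothing; the vertical part is the one-dimensional identity on each vertical
    -- line.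
    set q := initCoord n e
    set s := e (Fin.last n) with hs
    have hhor : ∫ z in halfSpace n a, w (z (Fin.last n)) * fderiv ℝ φ z (horizontal n q) = 0 := by
      rw [setIntegral_halfSpace_eq (integrableOn_mul_fderiv_testFunction hφ hWφ _)]
      simp_rw [horizontal_add_smul_lastVec_last, integral_const_mul,
        integral_fderiv_horizontal_eq_zero hφ, mul_zero, integral_zero]
    have hver : ∫ z in halfSpace n a, w (z (Fin.last n)) * fderiv ℝ φ z (lastVec n) =
        - ∫ z in halfSpace n a, w' (z (Fin.last n)) * φ z := by
      rw [setIntegral_halfSpace_eq_swap (integrableOn_mul_fderiv_testFunction hφ hWφ _),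
        setIntegral_halfSpace_eq_swap (integrableOn_mul_testFunction hφ hWφ'), ← integral_neg]
      refine integral_congr_ae (ae_of_all _ fun y ↦ ?_)
      have h1 := h.integral_eq _ (hφ.slice y) 1
      simp only [(hasFDerivAt_comp_slice hd y _).fderiv] at h1
      simpa [mul_comm] using h1
    have hsplit : ∀ z, w (z (Fin.last n)) * fderiv ℝ φ z e =
        w (z (Fin.last n)) * fderiv ℝ φ z (horizontal n q) +
          s * (w (z (Fin.last n)) * fderiv ℝ φ z (lastVec n)) := fun z ↦ by
      conv_lhs => rw [← horizontal_initCoord_add e]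
      simp [q, s]
      ring
    simp_rw [hsplit]
    rw [integral_add (integrableOn_mul_fderiv_testFunction hφ hWφ _)
      ((integrableOn_mul_fderiv_testFunction hφ hWφ _).const_mul s), integral_const_mul, hhor,
      hver, zero_add, mul_neg, ← integral_const_mul]
    congr 1
    refine integral_congr_ae (ae_of_all _ fun z ↦ ?_)
    have : inner ℝ (lastVec n) e = s := by simp [lastVec, hs, EuclideanSpace.inner_single_left]
    simp only [real_inner_smul_left, this]
    ring

/-- A weak supersolution on a half-line is a weak supersolution on the half-space. -/
theorem IsWeakSupersolution.comp_last {σ w w' : ℝ → ℝ}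
    (hw : IsWeakSupersolution (Ioi a) σ w w') (h : HasH1LocGradient (Ioi a) w w')
    (hσm : Measurable σ) {c : ℝ} (hσc : ∀ t, |σ t| ≤ c) :
    IsWeakSupersolution (halfSpace n a) (fun z ↦ σ (z (Fin.last n)))
      (fun z ↦ w (z (Fin.last n))) (fun z ↦ w' (z (Fin.last n)) • lastVec n) := by
  intro φ hφ hφ0
  have hd := hφ.smooth.differentiable (by simp)
  have hWφ := memLp_comp_last (n := n) h.memLp_function hφ.support_subset hφ.compactSupport
  have hWφ' : MemLp (fun z : EuclideanSpace ℝ (Fin (n + 1)) ↦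
      σ (z (Fin.last n)) * w' (z (Fin.last n))) 2 (volume.restrict (tsupport φ)) := by
    refine memLp_comp_last (n := n) (w := fun t ↦ σ t * w' t) (fun K hKU hK ↦ ?_)
      hφ.support_subset hφ.compactSupport
    have hm := h.memLp_gradient K hKU hK
    exact hm.of_le_mul (hσm.aestronglyMeasurable.mul hm.1) (c := c) (ae_of_all _ fun t ↦ by
      rw [norm_mul]
      gcongr
      exact hσc t)
  have hint := Integrable.add (integrableOn_mul_fderiv_testFunction hφ hWφ' (lastVec n))
    (integrableOn_mul_testFunction hφ hWφ)
  have heq : weakForm (halfSpace n a) (fun z ↦ σ (z (Fin.last n)))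
      (fun z ↦ w (z (Fin.last n))) (fun z ↦ w' (z (Fin.last n)) • lastVec n) φ =
      ∫ z in halfSpace n a, (σ (z (Fin.last n)) * w' (z (Fin.last n)) * fderiv ℝ φ z (lastVec n) +
        w (z (Fin.last n)) * φ z) := by
    simp [weakForm, mul_assoc]
  rw [heq, setIntegral_halfSpace_eq_swap (by exact hint)]
  -- On every vertical line the slice of φ is a nonnegative test function, so the inner integral is
  -- nonnegative.
  refine integral_nonneg fun y ↦ ?_
  have h1 := hw _ (hφ.slice y) fun t ↦ hφ0 _
  rw [weakForm] at h1
  simp only [(hasFDerivAt_comp_slice hd y _).fderiv] at h1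
  simpa [mul_assoc] using h1

end Lifting

/-! ### Null boundaries, decay by doubling, and the function exp(-1/t). -/

section Auxiliary

open Filter Topology

/-- A `C²` boundary has measure zero. -/
theorem HasC2Boundary.measure_frontier_eq_zero {V : Type*} [NormedAddCommGroup V]
    [NormedSpace ℝ V] [FiniteDimensional ℝ V] [MeasurableSpace V] [BorelSpace V] (μ : Measure V)
    [μ.IsAddHaarMeasure] {D : Set V} (hD : HasC2Boundary D) (hDo : IsOpen D) :
    μ (frontier D) = 0 := by
  refine measure_null_of_locally_null _ fun p hp ↦ ?_
  obtain ⟨U, ρ, hU, hpU, hρ, hρ', hDU⟩ := hD p hp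
  obtain ⟨e, he⟩ : ∃ e, 0 < fderiv ℝ ρ p e := by
    obtain ⟨e, he⟩ := DFunLike.ne_iff.1 (hρ' p hpU)
    rcases lt_or_gt_of_ne he with h | h
    · exact ⟨-e, by simpa using h⟩
    · exact ⟨e, by simpa using h⟩
  have hcont : ContinuousOn (fun z ↦ fderiv ℝ ρ z e) U :=
    (hρ.continuousOn_fderiv_of_isOpen hU (by norm_num)).clm_apply continuousOn_const
  have hev : ∀ᶠ z in 𝓝 p, z ∈ U ∧ 0 < fderiv ℝ ρ z e :=
    (hU.eventually_mem hpU).and ((hcont.continuousAt (hU.mem_nhds hpU)).eventually (lt_mem_nhds he))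
  obtain ⟨r, hr, hball⟩ := Metric.eventually_nhds_iff_ball.1 hev
  set S := frontier D ∩ Metric.ball p r
  have hρ0 : ∀ z ∈ S, ρ z = 0 := by
    rintro z ⟨hz, hzr⟩
    have hzU := (hball z hzr).1
    refine le_antisymm ?_ (not_lt.1 fun hlt ↦ ?_)
    · by_contra! hpos
      have h1 : ∀ᶠ y in 𝓝 z, y ∈ U ∧ 0 < ρ y := (hU.eventually_mem hzU).and
        ((hρ.continuousOn.continuousAt (hU.mem_nhds hzU)).eventually (lt_mem_nhds hpos))
      obtain ⟨y, hy, hyD⟩ := mem_closure_iff_nhds.1 (frontier_subset_closure hz) _ h1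
      have : y ∈ {z ∈ U | ρ z < 0} := hDU ▸ ⟨hyD, hy.1⟩
      exact lt_asymm hy.2 this.2
    · have : z ∈ D ∩ U := hDU ▸ ⟨hzU, hlt⟩
      rw [hDo.frontier_eq] at hz
      exact hz.2 this.1
  -- ρ vanishes on `S` but has positive derivative along e throughout the ball, so by the mean value
  -- theorem a line in direction e meets `S` at most once.
  have hline : ∀ z ∈ S, ∀ t : ℝ, 0 < t → z + t • e ∉ S := by
    intro z hz t ht hzt
    have hseg : ∀ s ∈ Icc 0 t, z + s • e ∈ Metric.ball p r := by
      intro s hs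
      have := (convex_ball p r).add_smul_mem hz.2 hzt.2
        (t := s / t) ⟨div_nonneg hs.1 ht.le, (div_le_one ht).2 hs.2⟩
      rwa [smul_smul, div_mul_cancel₀ _ ht.ne'] at this
    have hder : ∀ s ∈ Icc 0 t, HasDerivAt (fun s : ℝ ↦ ρ (z + s • e))
        (fderiv ℝ ρ (z + s • e) e) s := by
      intro s hs
      have hd : DifferentiableAt ℝ ρ (z + s • e) :=
        (hρ.contDiffAt (hU.mem_nhds (hball _ (hseg s hs)).1)).differentiableAt (by norm_num)
      refine hd.hasFDerivAt.comp_hasDerivAt s ?_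
      simpa using ((hasDerivAt_id s).smul_const e).const_add z
    obtain ⟨s, hs, hs'⟩ := exists_hasDerivAt_eq_slope (fun s : ℝ ↦ ρ (z + s • e)) _ ht
      (fun s hs ↦ (hder s hs).continuousAt.continuousWithinAt)
      (fun s hs ↦ hder s (Ioo_subset_Icc_self hs))
    simp only [zero_smul, add_zero, hρ0 z hz, hρ0 _ hzt, sub_self, zero_div] at hs'
    exact (hball _ (hseg s (Ioo_subset_Icc_self hs))).2.ne' hs'
  refine ⟨S, inter_mem self_mem_nhdsWithin (mem_nhdsWithin_of_mem_nhds (Metric.ball_mem_nhds p hr)),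
    ?_⟩
  have hline' : ∀ z ∈ S, ∀ t : ℝ, t ≠ 0 → z + t • e ∉ S := by
    intro z hz t ht hzt
    rcases lt_or_gt_of_ne ht with h | h
    · exact hline _ hzt (-t) (neg_pos.2 h) (by simpa [add_assoc, ← add_smul] using hz)
    · exact hline _ hz t h hzt
  -- Infinitely many disjoint translates of the bounded set `S` by a bounded sequence fit into a set
  -- of finite measure, so `S` is null.
  refine Measure.addHaar_eq_zero_of_disjoint_translates μ (fun k : ℕ ↦ (1 / ((k : ℝ) + 1)) • e)
    ?_ ?_ (isClosed_frontier.measurableSet.inter measurableSet_ball)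
  · exact (Metric.isBounded_range_of_tendsto _
      (tendsto_one_div_add_atTop_nhds_zero_nat (𝕜 := ℝ) |>.smul_const e))
  · intro i j hij
    refine Set.disjoint_left.2 fun x hxi hxj ↦ ?_
    simp only [singleton_add, image_add_left, mem_preimage] at hxi hxj
    refine hline' _ hxi (1 / ((i : ℝ) + 1) - 1 / ((j : ℝ) + 1)) ?_ ?_
    · intro h
      rw [sub_eq_zero, one_div, one_div, inv_inj, add_left_inj, Nat.cast_inj] at h
      exact hij h
    · convert hxj using 1
      rw [sub_smul]
      abel

/-- Once R is large, each doubling gains a factor 2^-(N+1) while growth costs only 2^N. After k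
doublings a factor 2^-k remains. -/
theorem eq_zero_of_polynomial_growth {f : ℝ → ℝ} {N : ℕ} {C M R₀ : ℝ} (hf : ∀ R, 0 ≤ f R)
    (hC : 0 ≤ C) (hgrowth : ∀ R, 0 ≤ R → f R ≤ M * R ^ N)
    (hstep : ∀ R, R₀ < R → f R ≤ C / R ^ 2 * f (2 * R)) :
    ∃ R₁, ∀ R, R₁ < R → f R = 0 := by
  set q : ℝ := 2 ^ (N + 1) with hq
  have hq0 : 0 < q := by positivity
  -- R > 1 and R > Cq give R² > Cq, so C/R² is below 1/q.
  refine ⟨max R₀ (1 + C * q), fun R hR ↦ ?_⟩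
  have hR0 : R₀ < R := (le_max_left _ _).trans_lt hR
  have hRq : 1 + C * q < R := (le_max_right _ _).trans_lt hR
  have hCq : 0 ≤ C * q := by positivity
  have hRpos : 0 < R := by linarith
  have hiter : ∀ k : ℕ, f R ≤ q⁻¹ ^ k * f (2 ^ k * R) := by
    intro k
    induction k with
    | zero => simp
    | succ k ih =>
      have h2 : R ≤ 2 ^ k * R := le_mul_of_one_le_left hRpos.le (one_le_pow₀ (by norm_num))
      have h1 := hstep (2 ^ k * R) (hR0.trans_le h2)
      have h3 : C / (2 ^ k * R) ^ 2 ≤ q⁻¹ := by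
        rw [div_le_iff₀ (by positivity), inv_mul_eq_div, le_div_iff₀ hq0]
        nlinarith
      calc f R ≤ q⁻¹ ^ k * f (2 ^ k * R) := ih
        _ ≤ q⁻¹ ^ k * (q⁻¹ * f (2 * (2 ^ k * R))) := by
            gcongr
            exact h1.trans (mul_le_mul_of_nonneg_right h3 (hf _))
        _ = q⁻¹ ^ (k + 1) * f (2 ^ (k + 1) * R) := by
            rw [← mul_assoc, ← pow_succ, ← mul_assoc, ← pow_succ']
  have hlim : Tendsto (fun k : ℕ ↦ M * R ^ N * (1 / 2) ^ k) atTop (𝓝 0) := by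
    simpa using (tendsto_pow_atTop_nhds_zero_of_lt_one (r := (1 / 2 : ℝ)) (by norm_num)
      (by norm_num)).const_mul (M * R ^ N)
  refine le_antisymm (ge_of_tendsto' hlim fun k ↦ (hiter k).trans ?_) (hf R)
  calc q⁻¹ ^ k * f (2 ^ k * R) ≤ q⁻¹ ^ k * (M * (2 ^ k * R) ^ N) := by
        gcongr
        exact hgrowth _ (by positivity)
    _ = M * R ^ N * (1 / 2) ^ k := by
        rw [hq, pow_succ, mul_inv, mul_pow, mul_pow, ← pow_mul, inv_pow, inv_pow, ← pow_mul,
          mul_comm k N, one_div, inv_pow]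
        field_simp

/-- This identity motivates the choice of Φ: Φ²/Φ' = t²Φ for t > 0, which for bounded t is
controlled by the quantity tΦ being estimated. For t ≤ 0 both sides vanish. -/
theorem deriv_expNegInvGlue (t : ℝ) : deriv expNegInvGlue t = t⁻¹ ^ 2 * expNegInvGlue t := by
  have h := expNegInvGlue.hasDerivAt_polynomial_eval_inv_mul 1 t
  simp only [Polynomial.eval_one, one_mul, Polynomial.derivative_one, sub_zero, mul_one,
    Polynomial.eval_pow, Polynomial.eval_X] at h
  exact h.deriv

theorem expNegInvGlue_le_one (t : ℝ) : expNegInvGlue t ≤ 1 := by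
  rcases le_or_gt t 0 with h | h
  · simp [expNegInvGlue.zero_of_nonpos h]
  · rw [expNegInvGlue, if_neg h.not_ge]
    exact Real.exp_le_one_iff.2 (by simpa using h.le)

/-- With s = 1/t the claim is s² ≤ 2eˢ, read off from 1 + s + s²/2 ≤ eˢ. -/
theorem abs_deriv_expNegInvGlue_le (t : ℝ) : |deriv expNegInvGlue t| ≤ 2 := by
  rw [deriv_expNegInvGlue, abs_of_nonneg (mul_nonneg (sq_nonneg _) (expNegInvGlue.nonneg _))]
  rcases le_or_gt t 0 with h | h
  · simp [expNegInvGlue.zero_of_nonpos h]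
  · rw [expNegInvGlue, if_neg h.not_ge, Real.exp_neg, ← div_eq_mul_inv,
      div_le_iff₀ (Real.exp_pos _)]
    have := Real.quadratic_le_exp_of_nonneg (inv_nonneg.2 h.le)
    have := inv_pos.2 h
    linarith

/-- Young's inequality in the form needed to absorb the gradient of a cutoff function. -/
theorem young_absorb {X Y σ p d t B Φ η : ℝ} (hσ : 0 ≤ σ) (ht : 0 < t) (htB : t ≤ B)
    (hΦ : 0 ≤ Φ) (hX : σ * p ^ 2 ≤ X) (hY : |Y| ≤ σ * (p * d)) :
    t * Φ * η ^ 2 - σ * B * d ^ 2 * (t * Φ) ≤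
      t⁻¹ ^ 2 * Φ * η ^ 2 * X + 2 * Φ * η * Y + t * Φ * η ^ 2 := by
  have h1 : -(|η| * (σ * (p * d))) ≤ η * Y := by
    have : |η * Y| ≤ |η| * (σ * (p * d)) := by
      rw [abs_mul]
      gcongr
    exact (neg_le_neg this).trans (neg_abs_le _)
  have h2 : t⁻¹ ^ 2 * η ^ 2 * (σ * p ^ 2) ≤ t⁻¹ ^ 2 * η ^ 2 * X := by gcongr
  have h3 : σ * t ^ 2 * d ^ 2 ≤ σ * B * d ^ 2 * t := by
    have : σ * d ^ 2 * t * t ≤ σ * d ^ 2 * t * B := by gcongr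
    nlinarith
  -- Completed square behind Young's inequality, after division by Φ; the weight t⁻¹ matches Φ' =
  -- t⁻²Φ, and `h3` uses t ≤ B to trade t² for Bt.
  have h4 : 0 ≤ σ * (t⁻¹ * |η| * p - t * d) ^ 2 := by positivity
  have h5 : σ * (t⁻¹ * |η| * p - t * d) ^ 2 = t⁻¹ ^ 2 * η ^ 2 * (σ * p ^ 2) -
      2 * (|η| * (σ * (p * d))) + σ * t ^ 2 * d ^ 2 := by
    rw [← sq_abs η]
    field_simp
    ring
  have h6 : 0 ≤ t⁻¹ ^ 2 * η ^ 2 * X + 2 * (η * Y) + σ * B * d ^ 2 * t := by linarith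
  have h7 := mul_nonneg hΦ h6
  linarith

end Auxiliary

/-! ### Cutoffs with no vertical derivative in the slab. -/

section Cutoff

open Filter Topology

variable {n : ℕ}

/-- A smooth cutoff function of the unit ball, independent of the last coordinate near the
hyperplane on which it vanishes. -/
noncomputable def cylinderCutoff (n : ℕ) (x : EuclideanSpace ℝ (Fin (n + 1))) : ℝ :=
  Real.smoothTransition (2 - x (Fin.last n) ^ 2) *
    Real.smoothTransition (2 - (‖x‖ ^ 2 - x (Fin.last n) ^ 2))

theorem contDiff_cylinderCutoff : ContDiff ℝ ∞ (cylinderCutoff n) := by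
  have h1 : ContDiff ℝ ∞ fun x : EuclideanSpace ℝ (Fin (n + 1)) ↦ x (Fin.last n) :=
    (lastCoord n).contDiff
  exact (Real.smoothTransition.contDiff.comp (contDiff_const.sub (h1.pow 2))).mul
    (Real.smoothTransition.contDiff.comp
      (contDiff_const.sub ((contDiff_norm_sq ℝ).sub (h1.pow 2))))

theorem sq_last_le_norm_sq (x : EuclideanSpace ℝ (Fin (n + 1))) :
    x (Fin.last n) ^ 2 ≤ ‖x‖ ^ 2 := by
  rw [← sq_abs]
  exact pow_le_pow_left₀ (abs_nonneg _) (PiLp.norm_apply_le x (Fin.last n)) 2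

theorem cylinderCutoff_eq_one {x : EuclideanSpace ℝ (Fin (n + 1))} (hx : ‖x‖ ≤ 1) :
    cylinderCutoff n x = 1 := by
  have h1 := sq_last_le_norm_sq x
  have h2 : ‖x‖ ^ 2 ≤ 1 := pow_le_one₀ (norm_nonneg _) hx
  have h3 := sq_nonneg (x (Fin.last n))
  rw [cylinderCutoff, Real.smoothTransition.one_of_one_le (by linarith),
    Real.smoothTransition.one_of_one_le (by linarith), one_mul]

theorem support_cylinderCutoff : Function.support (cylinderCutoff n) ⊆ Metric.closedBall 0 2 := by
  intro x hx
  by_contra hnot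
  rw [mem_closedBall_zero_iff, not_le] at hnot
  have h2 : 4 < ‖x‖ ^ 2 := by nlinarith
  apply hx
  rcases le_total 2 (x (Fin.last n) ^ 2) with h | h
  · rw [cylinderCutoff, Real.smoothTransition.zero_of_nonpos (by linarith), zero_mul]
  · rw [cylinderCutoff, Real.smoothTransition.zero_of_nonpos
      (x := 2 - (‖x‖ ^ 2 - x (Fin.last n) ^ 2)) (by linarith), mul_zero]

theorem tsupport_cylinderCutoff : tsupport (cylinderCutoff n) ⊆ Metric.closedBall 0 2 :=
  closure_minimal support_cylinderCutoff Metric.isClosed_closedBall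

/-- Near such x the first factor is identically 1, and the second depends only on the horizontal
coordinates, through ‖x‖² - x_N². -/
theorem fderiv_cylinderCutoff_lastVec {x : EuclideanSpace ℝ (Fin (n + 1))}
    (hx : |x (Fin.last n)| < 1) : fderiv ℝ (cylinderCutoff n) x (lastVec n) = 0 := by
  have hd := (contDiff_cylinderCutoff.differentiable (by simp) x).hasFDerivAt.hasLineDerivAt
    (lastVec n)
  refine hd.unique (HasDerivAt.congr_of_eventuallyEq (hasDerivAt_const (0 : ℝ)
    (Real.smoothTransition (2 - (‖x‖ ^ 2 - x (Fin.last n) ^ 2)))) ?_)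
  have hc : Tendsto (fun s : ℝ ↦ |x (Fin.last n) + s|) (𝓝 0) (𝓝 |x (Fin.last n)|) := by
    have : Continuous fun s : ℝ ↦ |x (Fin.last n) + s| := by fun_prop
    simpa using this.tendsto 0
  filter_upwards [hc.eventually (gt_mem_nhds hx)] with s hs
  have hlast : (x + s • lastVec n) (Fin.last n) = x (Fin.last n) + s := by simp
  have hnorm : ‖x + s • lastVec n‖ ^ 2 = ‖x‖ ^ 2 + 2 * (s * x (Fin.last n)) + s ^ 2 := by
    rw [norm_add_sq_real]
    simp [lastVec, norm_smul, inner_smul_right, EuclideanSpace.inner_single_right]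
  have hsq : (x (Fin.last n) + s) ^ 2 ≤ 1 := by
    rw [← sq_abs]
    exact pow_le_one₀ (abs_nonneg _) hs.le
  rw [cylinderCutoff, hlast, hnorm, Real.smoothTransition.one_of_one_le (by linarith), one_mul]
  congr 1
  ring

/-- Cutoff functions for the part of the half-space `{z_N > ℓ}` in a large ball, with derivative
in the last direction vanishing where `z_N ≤ L`. -/
theorem exists_cutoff (n : ℕ) {ℓ : ℝ} (hℓ : 0 < ℓ) :
    ∃ C, 0 ≤ C ∧ ∀ L R : ℝ, ℓ < L → L < R →
      ∃ η : EuclideanSpace ℝ (Fin (n + 1)) → ℝ, IsTestFunction (halfSpace n 0) η ∧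
        ∀ z ∈ halfSpace n ℓ, (‖z‖ ≤ R → η z = 1) ∧ ‖fderiv ℝ η z‖ ≤ C / R ∧
          (2 * R < ‖z‖ → fderiv ℝ η z = 0) ∧
          (z (Fin.last n) ≤ L → fderiv ℝ η z (lastVec n) = 0) := by
  have hs : HasCompactSupport (cylinderCutoff n) :=
    HasCompactSupport.of_support_subset_isCompact (isCompact_closedBall _ _) support_cylinderCutoff
  obtain ⟨C, hC⟩ := (contDiff_cylinderCutoff.continuous_fderiv
    (by simp)).bounded_above_of_compact_support (hs.fderiv ℝ)
  refine ⟨C, (norm_nonneg _).trans (hC 0), fun L R hL hR ↦ ?_⟩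
  have hRpos : 0 < R := hℓ.trans (hL.trans hR)
  set ψ : EuclideanSpace ℝ (Fin (n + 1)) → ℝ := fun z ↦ cylinderCutoff n (R⁻¹ • z) with hψ
  -- The extra factor vanishes for z_N ≤ ℓ/2 and equals 1 for z_N ≥ ℓ. Its derivative lives outside
  -- E, so it does not affect the estimates, and `C` depends only on n.
  set η : EuclideanSpace ℝ (Fin (n + 1)) → ℝ := fun z ↦
    Real.smoothTransition (2 / ℓ * z (Fin.last n) - 1) * ψ z with hη
  have hlast : ContDiff ℝ ∞ fun x : EuclideanSpace ℝ (Fin (n + 1)) ↦ x (Fin.last n) :=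
    (lastCoord n).contDiff
  have hψc : ContDiff ℝ ∞ ψ := contDiff_cylinderCutoff.comp (contDiff_const_smul _)
  have hψd : ∀ z, fderiv ℝ ψ z = R⁻¹ • fderiv ℝ (cylinderCutoff n) (R⁻¹ • z) := fun z ↦
    fderiv_comp_smul _
  have hηE : ∀ z ∈ halfSpace n ℓ, η z = ψ z := by
    intro z hz
    have hz' : ℓ < z (Fin.last n) := hz
    have : 2 ≤ 2 / ℓ * z (Fin.last n) := by
      rw [div_mul_eq_mul_div, le_div_iff₀ hℓ]
      linarith
    simp only [hη]
    rw [Real.smoothTransition.one_of_one_le (by linarith), one_mul]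
  have hηd : ∀ z ∈ halfSpace n ℓ, fderiv ℝ η z =
      R⁻¹ • fderiv ℝ (cylinderCutoff n) (R⁻¹ • z) := fun z hz ↦ by
    rw [← hψd]
    exact Filter.EventuallyEq.fderiv_eq
      (Filter.eventually_of_mem ((isOpen_halfSpace ℓ).mem_nhds hz) hηE)
  have hnorm : ∀ z : EuclideanSpace ℝ (Fin (n + 1)), ‖R⁻¹ • z‖ = ‖z‖ / R := fun z ↦ by
    rw [norm_smul, norm_inv, Real.norm_of_nonneg hRpos.le, inv_mul_eq_div]
  set K : Set (EuclideanSpace ℝ (Fin (n + 1))) :=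
    Metric.closedBall 0 (2 * R) ∩ {z | ℓ / 2 ≤ z (Fin.last n)} with hK
  have hKc : IsCompact K :=
    (isCompact_closedBall _ _).inter_right (isClosed_le continuous_const (lastCoord n).continuous)
  have hsupp : Function.support η ⊆ K := by
    intro z hz
    refine ⟨?_, ?_⟩
    · have := support_cylinderCutoff (right_ne_zero_of_mul hz)
      rw [mem_closedBall_zero_iff, hnorm, div_le_iff₀ hRpos] at this
      simpa using this
    · have h1 := left_ne_zero_of_mul hz
      rw [Ne, Real.smoothTransition.zero_iff_nonpos, not_le, sub_pos, div_mul_eq_mul_div,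
        lt_div_iff₀ hℓ] at h1
      change ℓ / 2 ≤ z (Fin.last n)
      linarith
  refine ⟨η, ⟨?_, HasCompactSupport.of_support_subset_isCompact hKc hsupp, ?_⟩, fun z hz ↦
    ⟨fun hzR ↦ ?_, ?_, fun hzR ↦ ?_, fun hzL ↦ ?_⟩⟩
  · exact (Real.smoothTransition.contDiff.comp ((contDiff_const.mul hlast).sub contDiff_const)).mul
      hψc
  · refine (closure_minimal hsupp hKc.isClosed).trans fun z hz ↦ ?_
    have : ℓ / 2 ≤ z (Fin.last n) := hz.2
    change 0 < z (Fin.last n)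
    linarith
  · rw [hηE z hz]
    exact cylinderCutoff_eq_one (by rw [hnorm]; exact div_le_one_of_le₀ hzR hRpos.le)
  · rw [hηd z hz, norm_smul, norm_inv, Real.norm_of_nonneg hRpos.le, inv_mul_eq_div]
    gcongr
    exact hC _
  · rw [hηd z hz, fderiv_eq_zero_of_notMem_tsupport, smul_zero]
    intro h
    have := tsupport_cylinderCutoff h
    rw [mem_closedBall_zero_iff, hnorm, div_le_iff₀ hRpos] at this
    linarith
  · have hz' : ℓ < z (Fin.last n) := hz
    have h1 : |(R⁻¹ • z) (Fin.last n)| < 1 := by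
      have h2 : (R⁻¹ • z) (Fin.last n) = z (Fin.last n) / R := by simp [inv_mul_eq_div]
      rw [h2, abs_of_nonneg (div_nonneg (by linarith) hRpos.le), div_lt_one hRpos]
      linarith
    rw [hηd z hz, smul_apply, fderiv_cylinderCutoff_lastVec h1, smul_zero]

end Cutoff

/-! ### The difference inequality and the flux. -/

section Comparison

open Filter Topology

variable {n : ℕ} {a : ℝ}

theorem integrableOn_fderiv_apply {φ : EuclideanSpace ℝ (Fin (n + 1)) → ℝ}
    (hφ : IsTestFunction (halfSpace n a) φ)
    {H : EuclideanSpace ℝ (Fin (n + 1)) → EuclideanSpace ℝ (Fin (n + 1))}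
    (hH : MemLp H 2 (volume.restrict (tsupport φ))) :
    IntegrableOn (fun z ↦ fderiv ℝ φ z (H z)) (halfSpace n a) := by
  obtain ⟨c, hc⟩ := hφ.exists_bound_fderiv
  have hK : IsCompact (tsupport φ) := hφ.compactSupport
  have : IsFiniteMeasure ((volume : Measure (EuclideanSpace ℝ (Fin (n + 1)))).restrict
    (tsupport φ)) := ⟨by rw [Measure.restrict_apply_univ]; exact hK.measure_lt_top⟩
  have hm : AEStronglyMeasurable (fun z ↦ fderiv ℝ φ z (H z)) (volume.restrict (tsupport φ)) :=
    (ContinuousLinearMap.id ℝ (EuclideanSpace ℝ (Fin (n + 1)) →L[ℝ] ℝ)).aestronglyMeasurable_comp₂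
      hφ.continuous_fderiv.aestronglyMeasurable hH.1
  have h : IntegrableOn (fun z ↦ fderiv ℝ φ z (H z)) (tsupport φ) :=
    ((hH.integrable (by norm_num)).norm.const_mul c).mono' hm (ae_of_all _ fun z ↦
      ((fderiv ℝ φ z).le_opNorm _).trans (mul_le_mul_of_nonneg_right (hc z) (norm_nonneg _)))
  exact h.of_forall_sdiff_eq_zero (measurableSet_halfSpace a) fun z hz ↦ by
    simp [fderiv_eq_zero_of_notMem_tsupport hz.2]

theorem HasH1LocGradient.sub {w₁ w₂ : EuclideanSpace ℝ (Fin (n + 1)) → ℝ}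
    {G₁ G₂ : EuclideanSpace ℝ (Fin (n + 1)) → EuclideanSpace ℝ (Fin (n + 1))}
    (h₁ : HasH1LocGradient (halfSpace n a) w₁ G₁) (h₂ : HasH1LocGradient (halfSpace n a) w₂ G₂) :
    HasH1LocGradient (halfSpace n a) (fun z ↦ w₁ z - w₂ z) (fun z ↦ G₁ z - G₂ z) := by
  refine ⟨fun K hKU hK ↦ (h₁.1 K hKU hK).sub (h₂.1 K hKU hK),
    fun K hKU hK ↦ (h₁.2 K hKU hK).sub (h₂.2 K hKU hK), fun φ hφ e ↦ ?_⟩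
  have hw := fun w (hw : MemLp w 2 (volume.restrict (tsupport φ))) ↦
    integrableOn_mul_fderiv_testFunction hφ hw e
  have hg : ∀ G : EuclideanSpace ℝ (Fin (n + 1)) → EuclideanSpace ℝ (Fin (n + 1)),
      MemLp G 2 (volume.restrict (tsupport φ)) →
      IntegrableOn (fun z ↦ φ z * inner ℝ (G z) e) (halfSpace n a) := fun G hG ↦ by
    simp_rw [mul_comm (φ _)]
    exact integrableOn_mul_testFunction hφ (hG.inner_const e)
  have hs := hφ.support_subset
  have hc : IsCompact (tsupport φ) := hφ.compactSupport
  simp_rw [sub_mul, inner_sub_left, mul_sub]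
  rw [integral_sub (hw _ (h₁.1 _ hs hc)) (hw _ (h₂.1 _ hs hc)),
    integral_sub (hg _ (h₁.2 _ hs hc)) (hg _ (h₂.2 _ hs hc)), h₁.3 φ hφ e, h₂.3 φ hφ e]
  ring

theorem measurable_conductivity {V : Type*} [MeasurableSpace V] {A : Set V} (hA : MeasurableSet A)
    (σc σs : ℝ) : Measurable (conductivity A σc σs) :=
  Measurable.ite hA measurable_const measurable_const

theorem abs_conductivity_le {V : Type*} (A : Set V) {σc σs : ℝ} (hσc : 0 < σc) (hσs : 0 < σs)
    (z : V) : |conductivity A σc σs z| ≤ σc + σs := by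
  unfold conductivity
  split_ifs
  · rw [abs_of_pos hσc]
    linarith
  · rw [abs_of_pos hσs]
    linarith

theorem memLp_two_smul {V E : Type*} [MeasurableSpace V] [NormedAddCommGroup E] [NormedSpace ℝ E]
    {μ : Measure V} {σ : V → ℝ} {H : V → E} {c : ℝ} (hσ : Measurable σ) (hσc : ∀ z, |σ z| ≤ c)
    (hH : MemLp H 2 μ) : MemLp (fun z ↦ σ z • H z) 2 μ :=
  hH.of_le_mul (hσ.aestronglyMeasurable.smul hH.1) (c := c) (ae_of_all _ fun z ↦ by
    rw [norm_smul]
    exact mul_le_mul_of_nonneg_right (hσc z) (norm_nonneg _))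

/-- The difference of a weak solution and a weak supersolution. -/
theorem integral_sub_le_zero_of_isWeakSolution
    {w₁ w₂ σ₁ σ₂ : EuclideanSpace ℝ (Fin (n + 1)) → ℝ}
    {G₁ G₂ : EuclideanSpace ℝ (Fin (n + 1)) → EuclideanSpace ℝ (Fin (n + 1))} {c : ℝ}
    (h₁ : HasH1LocGradient (halfSpace n a) w₁ G₁) (h₂ : HasH1LocGradient (halfSpace n a) w₂ G₂)
    (hσ₁ : Measurable σ₁) (hσ₂ : Measurable σ₂) (hc₁ : ∀ z, |σ₁ z| ≤ c) (hc₂ : ∀ z, |σ₂ z| ≤ c)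
    (hsol : IsWeakSolution (halfSpace n a) σ₁ w₁ G₁)
    (hsuper : IsWeakSupersolution (halfSpace n a) σ₂ w₂ G₂)
    {φ : EuclideanSpace ℝ (Fin (n + 1)) → ℝ} (hφ : IsTestFunction (halfSpace n a) φ)
    (hφ0 : ∀ z, 0 ≤ φ z) :
    ∫ z in halfSpace n a, (fderiv ℝ φ z (σ₁ z • G₁ z - σ₂ z • G₂ z) + (w₁ z - w₂ z) * φ z) ≤ 0 := by
  have hs := hφ.support_subset
  have hc : IsCompact (tsupport φ) := hφ.compactSupport
  have key : ∀ {w σ : EuclideanSpace ℝ (Fin (n + 1)) → ℝ}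
      {G : EuclideanSpace ℝ (Fin (n + 1)) → EuclideanSpace ℝ (Fin (n + 1))},
      HasH1LocGradient (halfSpace n a) w G → Measurable σ → (∀ z, |σ z| ≤ c) →
      IntegrableOn (fun z ↦ σ z * fderiv ℝ φ z (G z) + w z * φ z) (halfSpace n a) := by
    intro w σ G h hσ hσc
    have h1 := Integrable.add (integrableOn_fderiv_apply hφ (memLp_two_smul hσ hσc (h.2 _ hs hc)))
      (integrableOn_mul_testFunction hφ (h.1 _ hs hc))
    refine h1.congr (ae_of_all _ fun z ↦ ?_)
    simp
  have h1 := hsol φ hφ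
  have h2 := hsuper φ hφ hφ0
  rw [weakForm] at h1 h2
  have h3 := integral_sub (key h₁ hσ₁ hc₁) (key h₂ hσ₂ hc₂)
  refine le_of_eq_of_le ((integral_congr_ae (ae_of_all _ fun z ↦ ?_)).trans h3) (by linarith)
  simp only [map_sub, map_smul, smul_eq_mul]
  ring

theorem MemLInfty.exists_bound {V : Type*} [NormedAddCommGroup V] [InnerProductSpace ℝ V]
    [MeasureSpace V] {U : Set V} {w : V → ℝ} (h : MemLInfty U w) :
    ∃ B, 0 ≤ B ∧ ∀ᵐ z ∂(volume.restrict U), |w z| ≤ B := by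
  refine ⟨(eLpNormEssSup w (volume.restrict U)).toReal, ENNReal.toReal_nonneg, ?_⟩
  have hfin : eLpNormEssSup w (volume.restrict U) < ⊤ := by
    rw [← eLpNorm_exponent_top]
    exact h.2
  filter_upwards [enorm_ae_le_eLpNormEssSup w (volume.restrict U)] with z hz
  have := ENNReal.toReal_mono hfin.ne hz
  simpa using this

/-- The flux `σ₁∇w₁ - σ₂∇w₂` controls the gradient of the cutoff only through a vector `P` that is
itself controlled by the flux. -/
theorem exists_flux_bound {σc σs g : ℝ} (hσs : 0 ≤ σs)
    {G₁ : EuclideanSpace ℝ (Fin (n + 1))}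
    (hsign : 0 ≤ (σc * g - σs * G₁ (Fin.last n)) * (g - G₁ (Fin.last n)))
    {T : EuclideanSpace ℝ (Fin (n + 1)) →L[ℝ] ℝ} (hT : T (lastVec n) = 0) :
    ∃ p, σs * p ^ 2 ≤ inner ℝ (G₁ - g • lastVec n) (σs • G₁ - σc • (g • lastVec n)) ∧
      |T (σs • G₁ - σc • (g • lastVec n))| ≤ σs * (p * ‖T‖) := by
  set s := G₁ (Fin.last n)
  -- The horizontal part of G₁. Being orthogonal to the last basis vector, it gives no cross terms,
  -- and the purely vertical term is the product in `hsign`.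
  set P := G₁ - s • lastVec n with hP
  have hin : inner ℝ P (lastVec n) = 0 := by
    simp [hP, s, lastVec, inner_sub_left,
      EuclideanSpace.inner_single_right]
  have hin' : inner ℝ (lastVec n) P = 0 := by rw [real_inner_comm, hin]
  have hee : inner ℝ (lastVec n) (lastVec n) = (1 : ℝ) := by
    simp [lastVec]
  have hPP : inner ℝ P P = ‖P‖ ^ 2 := real_inner_self_eq_norm_sq P
  have hG : G₁ = P + s • lastVec n := by simp [hP]
  refine ⟨‖P‖, ?_, ?_⟩
  · have : inner ℝ (G₁ - g • lastVec n) (σs • G₁ - σc • (g • lastVec n)) =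
        σs * ‖P‖ ^ 2 + (σc * g - σs * s) * (g - s) := by
      rw [hG]
      simp only [inner_sub_left, inner_sub_right, inner_add_left, inner_add_right,
        real_inner_smul_left, real_inner_smul_right, hin, hin', hee, hPP]
      ring
    rw [this]
    linarith
  · have : T (σs • G₁ - σc • (g • lastVec n)) = σs * T P := by
      rw [hG]
      simp [hT]
    rw [this, abs_mul, abs_of_nonneg hσs, mul_comm ‖P‖]
    gcongr
    exact T.le_opNorm P

end Comparison

/-! ### Caccioppoli decay and conclusion. -/

section Main

open Filter Topology

theorem mul_expNegInvGlue_nonneg (t : ℝ) : 0 ≤ t * expNegInvGlue t := by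
  rcases le_or_gt t 0 with h | h
  · simp [expNegInvGlue.zero_of_nonpos h]
  · exact mul_nonneg h.le (expNegInvGlue.nonneg t)

theorem integrableOn_mul_expNegInvGlue {V : Type*} [MeasurableSpace V] {μ : Measure V}
    {S K : Set V} {v : V → ℝ} {B : ℝ} (hvm : AEStronglyMeasurable v (μ.restrict S))
    (hvB : ∀ᵐ z ∂(μ.restrict S), |v z| ≤ B) (hK : μ K < ⊤) :
    IntegrableOn (fun z ↦ v z * expNegInvGlue (v z)) (S ∩ K) μ := by
  have hle : μ.restrict (S ∩ K) ≤ μ.restrict S := Measure.restrict_mono inter_subset_left le_rfl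
  have : IsFiniteMeasure (μ.restrict (S ∩ K)) :=
    ⟨by rw [Measure.restrict_apply_univ]; exact (measure_mono inter_subset_right).trans_lt hK⟩
  refine Integrable.of_bound (C := B) ?_ ?_
  · exact ((continuous_id.mul
      (expNegInvGlue.contDiff (n := 0)).continuous).comp_aestronglyMeasurable hvm).mono_measure hle
  · filter_upwards [ae_mono hle hvB] with z hz
    rw [norm_mul, Real.norm_of_nonneg (expNegInvGlue.nonneg _)]
    exact (mul_le_of_le_one_right (abs_nonneg _) (expNegInvGlue_le_one _)).trans hz

/-- A bounded function whose positive part satisfies a Caccioppoli-type decay estimate on all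
large balls is nonpositive. -/
theorem ae_nonpos_of_caccioppoli {V : Type*} [NormedAddCommGroup V] [NormedSpace ℝ V]
    [FiniteDimensional ℝ V] [MeasureSpace V] [BorelSpace V] [(volume : Measure V).IsAddHaarMeasure]
    {S : Set V} {v : V → ℝ} {B C R₀ : ℝ} (hC : 0 ≤ C)
    (hvm : AEStronglyMeasurable v (volume.restrict S))
    (hvB : ∀ᵐ z ∂(volume.restrict S), |v z| ≤ B)
    (hstep : ∀ R, R₀ < R →
      ∫ z in S ∩ Metric.closedBall 0 R, v z * expNegInvGlue (v z) ≤
        C / R ^ 2 * ∫ z in S ∩ Metric.closedBall 0 (2 * R), v z * expNegInvGlue (v z)) :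
    ∀ᵐ z ∂(volume.restrict S), v z ≤ 0 := by
  set f : ℝ → ℝ := fun R ↦ ∫ z in S ∩ Metric.closedBall 0 R, v z * expNegInvGlue (v z) with hf
  have hint : ∀ R, IntegrableOn (fun z ↦ v z * expNegInvGlue (v z))
      (S ∩ Metric.closedBall 0 R) := fun R ↦
    integrableOn_mul_expNegInvGlue hvm hvB measure_closedBall_lt_top
  have hf0 : ∀ R, 0 ≤ f R := fun R ↦ integral_nonneg fun z ↦ mul_expNegInvGlue_nonneg _
  have hgrowth : ∀ R, 0 ≤ R →
      f R ≤ |B| * volume.real (Metric.ball (0 : V) 1) * R ^ Module.finrank ℝ V := by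
    intro R hR
    have hle : (volume : Measure V).restrict (S ∩ Metric.closedBall 0 R) ≤ volume.restrict S :=
      Measure.restrict_mono inter_subset_left le_rfl
    have hfin : volume (S ∩ Metric.closedBall (0 : V) R) < ⊤ :=
      (measure_mono inter_subset_right).trans_lt measure_closedBall_lt_top
    have h1 : ‖f R‖ ≤ |B| * volume.real (S ∩ Metric.closedBall (0 : V) R) :=
      norm_setIntegral_le_of_norm_le_const_ae hfin (by
        filter_upwards [ae_mono hle hvB] with z hz
        rw [norm_mul, Real.norm_of_nonneg (expNegInvGlue.nonneg _)]
        exact (mul_le_of_le_one_right (abs_nonneg _) (expNegInvGlue_le_one _)).trans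
          (hz.trans (le_abs_self B)))
    have h2 : volume.real (S ∩ Metric.closedBall (0 : V) R) ≤
        volume.real (Metric.ball (0 : V) 1) * R ^ Module.finrank ℝ V := by
      rw [mul_comm, ← Measure.addHaar_real_closedBall _ _ hR]
      exact measureReal_mono inter_subset_right measure_closedBall_lt_top.ne
    rw [mul_assoc]
    exact (le_abs_self _).trans (h1.trans (by gcongr))
  obtain ⟨R₁, hR₁⟩ := eq_zero_of_polynomial_growth hf0 hC hgrowth hstep
  -- The radii exceed R₁ and tend to infinity, so countably many balls on which the integrand
  -- vanishes almost everywhere cover `S`.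
  have hall : ∀ k : ℕ, ∀ᵐ z ∂(volume.restrict (S ∩ Metric.closedBall 0 (|R₁| + 1 + k))),
      v z * expNegInvGlue (v z) = 0 := fun k ↦
    (integral_eq_zero_iff_of_nonneg (fun z ↦ mul_expNegInvGlue_nonneg _) (hint _)).1
      (hR₁ _ (by have := le_abs_self R₁; have : (0 : ℝ) ≤ k := k.cast_nonneg; linarith))
  have hcover : S = ⋃ k : ℕ, S ∩ Metric.closedBall (0 : V) (|R₁| + 1 + k) := by
    rw [← inter_iUnion, eq_comm, inter_eq_left]
    intro z _
    obtain ⟨k, hk⟩ := exists_nat_ge ‖z‖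
    refine mem_iUnion.2 ⟨k, mem_closedBall_zero_iff.2 ?_⟩
    have := abs_nonneg R₁
    linarith
  rw [hcover, ae_restrict_iUnion_iff]
  refine fun k ↦ (hall k).mono fun z hz ↦ ?_
  by_contra! hpos
  exact (mul_pos hpos (expNegInvGlue.pos_of_pos hpos)).ne' hz

end Main

theorem propositionA4 (n : ℕ) (hn : 1 ≤ n) (L ℓ : ℝ) (hℓ : 0 < ℓ) (hL : ℓ < L)
    (D : Set (EuclideanSpace ℝ (Fin (n + 1))))
    (hD_open : IsOpen D) (hD_conn : IsConnected D) (hD_C2 : HasC2Boundary D)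
    (hFD : halfSpace n L ⊆ D) (hDE : D ⊆ halfSpace n ℓ)
    (σc σs : ℝ) (hσc : 0 < σc) (hσs : 0 < σs) (hσ : σc ≠ σs)
    (w₁ : EuclideanSpace ℝ (Fin (n + 1)) → ℝ)
    (G₁ : EuclideanSpace ℝ (Fin (n + 1)) → EuclideanSpace ℝ (Fin (n + 1)))
    (hw₁ : HasH1LocGradient (halfSpace n 0) w₁ G₁)
    (hw₁_bdd : MemLInfty (halfSpace n 0) w₁)
    (w₂ w₂' : ℝ → ℝ)
    (hw₂ : HasH1LocGradient (Ioi (0 : ℝ)) w₂ w₂')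
    (hw₂_bdd : MemLInfty (Ioi (0 : ℝ)) w₂)
    (h_sol : IsWeakSolution (halfSpace n 0) (conductivity D σc σs) w₁ G₁)
    (h_super : IsWeakSupersolution (Ioi (0 : ℝ)) (conductivity (Ioi ℓ) σc σs) w₂ w₂')
    (h_eq : ∀ᵐ z, z ∈ halfSpace n 0 \ halfSpace n ℓ → w₁ z = w₂ (z (Fin.last n)))
    (h_sign : ∀ᵐ z, z ∈ halfSpace n ℓ \ closure D →
      0 ≤ (σc * w₂' (z (Fin.last n)) - σs * G₁ z (Fin.last n)) *
        (w₂' (z (Fin.last n)) - G₁ z (Fin.last n))) :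
    (∀ᵐ z, z ∈ halfSpace n 0 → w₁ z ≤ w₂ (z (Fin.last n))) ∧
      (ContinuousOn w₁ (halfSpace n 0) → ContinuousOn w₂ (Ioi 0) →
        ∀ z ∈ halfSpace n 0, w₁ z ≤ w₂ (z (Fin.last n))) := by
  have hSm : MeasurableSet (halfSpace n 0) := measurableSet_halfSpace 0
  suffices hae : ∀ᵐ z, z ∈ halfSpace n 0 → w₁ z ≤ w₂ (z (Fin.last n)) by
    refine ⟨hae, fun hc₁ hc₂ z hz ↦ ?_⟩
    have hc₂' : ContinuousOn (fun z : EuclideanSpace ℝ (Fin (n + 1)) ↦ w₂ (z (Fin.last n)))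
        (halfSpace n 0) := hc₂.comp (lastCoord n).continuous.continuousOn fun z hz ↦ hz
    -- The inequality is recast as the equality max(w₁, w₂) = w₂, which extends from almost
    -- everywhere to everywhere by continuity.
    have h := Measure.eqOn_open_of_ae_eq (μ := volume)
      (f := fun z ↦ max (w₁ z) (w₂ (z (Fin.last n)))) (g := fun z ↦ w₂ (z (Fin.last n)))
      ((ae_restrict_iff' hSm).2 (hae.mono fun z hz hzS ↦ max_eq_right (hz hzS)))
      (isOpen_halfSpace 0) (hc₁.sup hc₂') hc₂' hz
    exact max_eq_right_iff.1 h
  rw [← ae_restrict_iff' hSm]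
  set G₂ : EuclideanSpace ℝ (Fin (n + 1)) → EuclideanSpace ℝ (Fin (n + 1)) :=
    fun z ↦ w₂' (z (Fin.last n)) • lastVec n with hG₂
  set v : EuclideanSpace ℝ (Fin (n + 1)) → ℝ := fun z ↦ w₁ z - w₂ (z (Fin.last n)) with hv
  have hW₂ : HasH1LocGradient (halfSpace n 0) (fun z ↦ w₂ (z (Fin.last n))) G₂ := hw₂.comp_last
  have hvG := hw₁.sub hW₂
  set σ₁ := conductivity D σc σs
  set σ₂ : EuclideanSpace ℝ (Fin (n + 1)) → ℝ :=
    fun z ↦ conductivity (Ioi ℓ) σc σs (z (Fin.last n)) with hσ₂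
  have hσ₁m : Measurable σ₁ := measurable_conductivity hD_open.measurableSet σc σs
  have hσm : Measurable (conductivity (Ioi ℓ) σc σs) :=
    measurable_conductivity measurableSet_Ioi σc σs
  have hσ₂m : Measurable σ₂ := hσm.comp (lastCoord n).continuous.measurable
  have hσ₁c := abs_conductivity_le D hσc hσs
  have hσ₂c := fun z : EuclideanSpace ℝ (Fin (n + 1)) ↦
    abs_conductivity_le (Ioi ℓ) hσc hσs (z (Fin.last n))
  have hsuper : IsWeakSupersolution (halfSpace n 0) σ₂ (fun z ↦ w₂ (z (Fin.last n))) G₂ :=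
    h_super.comp_last hw₂ hσm (abs_conductivity_le _ hσc hσs)
  set A : EuclideanSpace ℝ (Fin (n + 1)) → EuclideanSpace ℝ (Fin (n + 1)) :=
    fun z ↦ σ₁ z • G₁ z - σ₂ z • G₂ z with hA
  have hweak := fun φ hφ hφ0 ↦ integral_sub_le_zero_of_isWeakSolution (φ := φ) hw₁ hW₂ hσ₁m hσ₂m
    hσ₁c hσ₂c h_sol hsuper hφ hφ0
  obtain ⟨B₁, hB₁, hw₁B⟩ := hw₁_bdd.exists_bound
  obtain ⟨B₂, hB₂, hw₂B⟩ := hw₂_bdd.exists_bound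
  have hvB : ∀ᵐ z ∂(volume.restrict (halfSpace n 0)), |v z| ≤ B₁ + B₂ := by
    filter_upwards [hw₁B, (quasiMeasurePreserving_last 0).ae hw₂B] with z h1 h2
    exact (abs_sub _ _).trans (add_le_add h1 h2)
  have hvm : AEStronglyMeasurable v (volume.restrict (halfSpace n 0)) :=
    hw₁_bdd.1.sub (hw₂_bdd.1.comp_quasiMeasurePreserving (quasiMeasurePreserving_last 0))
  set h : EuclideanSpace ℝ (Fin (n + 1)) → ℝ := fun z ↦ v z * expNegInvGlue (v z) with hh
  obtain ⟨C, hC0, hC⟩ := exists_cutoff n hℓ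
  set M := (σc + σs) * (B₁ + B₂) with hM
  have hM0 : 0 ≤ M := by positivity
  suffices hv0 : ∀ᵐ z ∂(volume.restrict (halfSpace n 0)), v z ≤ 0 from
    hv0.mono fun z hz ↦ sub_nonpos.1 hz
  refine ae_nonpos_of_caccioppoli (C := M * C ^ 2) (R₀ := L) (by positivity) hvm hvB
    fun R hR ↦ ?_
  have hRpos : 0 < R := hℓ.trans (hL.trans hR)
  obtain ⟨η, hη, hηE⟩ := hC L R hL hR
  obtain ⟨hint, hle⟩ := hvG.integral_le_zero_of_weak_le (isOpen_halfSpace 0) (A := A)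
    (fun K hKU hK ↦ (memLp_two_smul hσ₁m hσ₁c (hw₁.2 K hKU hK)).sub
      (memLp_two_smul hσ₂m hσ₂c (hW₂.2 K hKU hK))) hweak
    (Φ := expNegInvGlue) (c := 2) expNegInvGlue.contDiff expNegInvGlue.nonneg
    (fun t ↦ by
      rw [abs_of_nonneg (expNegInvGlue.nonneg t)]
      linarith [expNegInvGlue_le_one t]) abs_deriv_expNegInvGlue_le hη
  -- One shape of estimate for both regions of E: σ = σc and p = |∇v| in D, σ = σs and p = |P|
  -- outside; the boundary of D is null.
  have hflux : ∀ᵐ z ∂(volume.restrict (halfSpace n 0)), z ∈ halfSpace n ℓ →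
      ∃ σ p, 0 ≤ σ ∧ σ ≤ σc + σs ∧ σ * p ^ 2 ≤ inner ℝ (G₁ z - G₂ z) (A z) ∧
        |fderiv ℝ η z (A z)| ≤ σ * (p * ‖fderiv ℝ η z‖) := by
    filter_upwards [ae_restrict_of_ae h_sign, ae_restrict_of_ae
      (measure_eq_zero_iff_ae_notMem.1 (hD_C2.measure_frontier_eq_zero volume hD_open))]
      with z hsign hfr hz
    have hσ₂z : σ₂ z = σc := if_pos hz
    by_cases hzD : z ∈ D
    · have hσ₁z : σ₁ z = σc := if_pos hzD
      have hAz : A z = σc • (G₁ z - G₂ z) := by simp only [hA, hσ₁z, hσ₂z, smul_sub]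
      refine ⟨σc, ‖G₁ z - G₂ z‖, hσc.le, by linarith, ?_, ?_⟩
      · rw [hAz, real_inner_smul_right, real_inner_self_eq_norm_sq]
      · rw [hAz, map_smul, smul_eq_mul, abs_mul, abs_of_pos hσc, mul_comm ‖G₁ z - G₂ z‖]
        gcongr
        exact (fderiv ℝ η z).le_opNorm _
    · have hσ₁z : σ₁ z = σs := if_neg hzD
      have hAz : A z = σs • G₁ z - σc • (w₂' (z (Fin.last n)) • lastVec n) := by
        simp only [hA, hσ₁z, hσ₂z, hG₂]
      -- F ⊆ D confines E \ D to the slab in which η has no vertical derivative.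
      have hzL : z (Fin.last n) ≤ L := not_lt.1 fun hlt ↦ hzD (hFD hlt)
      have hzc : z ∉ closure D := fun hcl ↦ hfr (by
        rw [hD_open.frontier_eq]
        exact ⟨hcl, hzD⟩)
      obtain ⟨p, hp1, hp2⟩ := exists_flux_bound hσs.le (hsign ⟨hz, hzc⟩) ((hηE z hz).2.2.2 hzL)
      rw [hAz]
      exact ⟨σs, p, hσs.le, by linarith, hp1, hp2⟩
  have hpt : ∀ᵐ z ∂(volume.restrict (halfSpace n 0)),
      (Metric.closedBall 0 R).indicator h z -
        M * C ^ 2 / R ^ 2 * (Metric.closedBall 0 (2 * R)).indicator h z ≤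
      deriv expNegInvGlue (v z) * η z ^ 2 * inner ℝ (G₁ z - G₂ z) (A z) +
        2 * expNegInvGlue (v z) * η z * fderiv ℝ η z (A z) +
        v z * expNegInvGlue (v z) * η z ^ 2 := by
    filter_upwards [hflux, hvB, ae_restrict_of_ae h_eq, ae_restrict_mem hSm] with z hfl hB heq hzS
    -- Where v ≤ 0, both sides vanish with Φ and Φ'. Where v > 0, the point is in E, since v = 0 on
    -- Ω \ E.
    rcases le_or_gt (v z) 0 with hv0 | hv0
    · have h0 : h z = 0 := by simp [hh, expNegInvGlue.zero_of_nonpos hv0]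
      simp [deriv_expNegInvGlue, expNegInvGlue.zero_of_nonpos hv0, indicator, h0]
    · have hz : z ∈ halfSpace n ℓ := by
        by_contra hz
        have := heq ⟨hzS, hz⟩
        simp [hv, this] at hv0
      obtain ⟨σ, p, hσ0, hσle, hX, hY⟩ := hfl hz
      obtain ⟨hη1, hηC, hη2, -⟩ := hηE z hz
      have hy := young_absorb (η := η z) hσ0 hv0 ((le_abs_self _).trans hB)
        (expNegInvGlue.nonneg (v z)) hX hY
      rw [deriv_expNegInvGlue]
      refine le_trans ?_ hy
      have hh0 : 0 ≤ h z := mul_expNegInvGlue_nonneg _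
      refine sub_le_sub ?_ ?_
      · by_cases hzR : z ∈ Metric.closedBall 0 R
        · rw [indicator_of_mem hzR, hη1 (mem_closedBall_zero_iff.1 hzR)]
          simp [hh]
        · rw [indicator_of_notMem hzR]
          exact mul_nonneg hh0 (sq_nonneg _)
      · by_cases hzR : z ∈ Metric.closedBall 0 (2 * R)
        · rw [indicator_of_mem hzR]
          have h1 : ‖fderiv ℝ η z‖ ^ 2 ≤ (C / R) ^ 2 := by gcongr
          have h2 : σ * (B₁ + B₂) * ‖fderiv ℝ η z‖ ^ 2 ≤ M * (C / R) ^ 2 := by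
            rw [hM]
            gcongr
          rw [mul_div_assoc, ← div_pow]
          exact mul_le_mul_of_nonneg_right h2 hh0
        · rw [indicator_of_notMem hzR, hη2 (by simpa using hzR)]
          simp
  have hind : ∀ r, IntegrableOn ((Metric.closedBall 0 r).indicator h) (halfSpace n 0) := fun r ↦ by
    rw [integrableOn_indicator_iff measurableSet_closedBall, inter_comm]
    exact integrableOn_mul_expNegInvGlue hvm hvB measure_closedBall_lt_top
  have hfin := (integral_mono_ae ((hind R).sub ((hind (2 * R)).const_mul (M * C ^ 2 / R ^ 2)))
    hint hpt).trans hle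
  have hsplit : ∫ z in halfSpace n 0, (Metric.closedBall 0 R).indicator h z -
      M * C ^ 2 / R ^ 2 * (Metric.closedBall 0 (2 * R)).indicator h z = _ :=
    integral_sub (hind R) ((hind (2 * R)).const_mul (M * C ^ 2 / R ^ 2))
  rw [integral_const_mul, setIntegral_indicator measurableSet_closedBall,
    setIntegral_indicator measurableSet_closedBall] at hsplit
  have hfin' := hsplit.symm.trans_le hfin
  linarith
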